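/- Let $d\ge 2$. Let $P_k$ be the Legendre (Gegenbauer) polynomials in dimension $d$, i.e. $P_0(t)=1$, $P_1(t)=t$ and $(k+d-2)P_{k+1}(t)=(2k+d-2)\,t\,P_k(t)-k\,P_{k-1}(t)$ for $k\ge 1$, and let $\omega_{p-1}=2\pi^{p/2}/\Gamma(p/2)$ be the surface area of the unit sphere of $\mathbb R^p$. For a continuous $\kappa:[-1,1]\to\mathbb R$, denote by $$\mu_k(\kappa)=\frac{\omega_{d-2}}{\omega_{d-1}}\int_{-1}^1\kappa(t)\,P_k(t)\,(1-t^2)^{(d-3)/2}\,dt ,\qquad k\ge 0,$$ the eigenvalues of the dot-product kernel $\kappa(x^\top y)$ on the unit sphere $\mathbb S^{d-1}$ of $\mathbb R^d$ (with its uniform probability measure). Let $$\kappa_1(u)=\tfrac1\pi\big(u(\pi-\arccos u)+\sqrt{1-u^2}\big),\qquad \kappa^L_{\mathrm{RF}}=\underbrace{\kappa_1\circ\cdots\circ\kappa_1}_{L-1\text{ times}}$$ ($\kappa^L_{\mathrm{RF}}$ is the random-features, or NNGP, kernel function of an $L$-layer ReLU network). Then for every $L\ge 3$ there are constants $C_{\mathrm{even}}(d,L)>0$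 and $C_{\mathrm{odd}}(d,L)>0$ with $C_{\mathrm{even}}(d,L)\ne C_{\mathrm{odd}}(d,L)$ such that, as $k\to\infty$, $$\mu_k(\kappa^L_{\mathrm{RF}})\sim C(d,L)\,k^{-d-2},\qquad C(d,L)=C_{\mathrm{even}}(d,L)\text{ for even }k,\quad C(d,L)=C_{\mathrm{odd}}(d,L)\text{ for odd }k .$$ Both constants grow linearly with $L$: there are $A>0$ and $B$ depending only on $d$ such that $|C_{\mathrm{even}}(d,L)-A L|\le B$ and $|C_{\mathrm{odd}}(d,L)-A L|\le B$ for all $L\ge 3$. The decay is, up to parity, the one of the shallow kernel $\kappa_1$: there is a constant $C(d)>0$ with $\mu_k(\kappa_1)\sim C(d)\,k^{-d-2}$ as $k\to\infty$ along even $k$, while $\mu_k(\kappa_1)=0$ for all large enough odd $k$. -/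

import Mathlib

open Polynomial Asymptotics Filter

noncomputable section

/-- The arc-cosine function `κ₁(u) = (u (π - arccos u) + √(1 - u²)) / π`. -/
def kappaOne (u : ℝ) : ℝ :=
  (u * (Real.pi - Real.arccos u) + Real.sqrt (1 - u ^ 2)) / Real.pi

/-- The random-features (NNGP) kernel function of an `L`-layer ReLU network (`L ≥ 2`):
`κ₁` composed with itself, `L - 1` factors in all. -/
def kappaRF (L : ℕ) : ℝ → ℝ := kappaOne^[L - 1]

/-- The Legendre (Gegenbauer) polynomials in dimension `d ≥ 2`, normalised by `P_k(1) = 1`,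
through their three-term recurrence
`(k + d - 2) P_{k+1}(t) = (2k + d - 2) t P_k(t) - k P_{k-1}(t)` for `k ≥ 1`.
The Rodrigues formula for them is `legendreDim_rodrigues` below. -/
def legendreDim (d : ℕ) : ℕ → ℝ[X]
  | 0 => 1
  | 1 => X
  | k + 2 =>
      C ((2 * (k : ℝ) + d) / ((k : ℝ) + d - 1)) * X * legendreDim d (k + 1)
        - C (((k : ℝ) + 1) / ((k : ℝ) + d - 1)) * legendreDim d k

/-- The surface area `2 π^{p/2} / Γ(p/2)` of the unit sphere of `ℝ^p`. -/
def sphereArea (p : ℕ) : ℝ :=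
  2 * Real.pi ^ ((p : ℝ) / 2) / Real.Gamma ((p : ℝ) / 2)

/-- The eigenvalue `μ_k` of degree `k` of the dot-product kernel `κ(⟨x, y⟩)` on the unit sphere
of `ℝ^d` with its uniform probability measure. -/
def dotEigenvalue (d : ℕ) (κ : ℝ → ℝ) (k : ℕ) : ℝ :=
  sphereArea (d - 1) / sphereArea d *
    ∫ t in (-1 : ℝ)..1, κ t * (legendreDim d k).eval t * (1 - t ^ 2) ^ (((d : ℝ) - 3) / 2)

theorem legendreDim_rec (d : ℕ) (hd : 2 ≤ d) (k : ℕ) (t : ℝ) :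
    ((k : ℝ) + d - 1) * (legendreDim d (k + 2)).eval t
      = (2 * (k : ℝ) + d) * t * (legendreDim d (k + 1)).eval t
        - ((k : ℝ) + 1) * (legendreDim d k).eval t := by
  have hd' : (2 : ℝ) ≤ d := by exact_mod_cast hd
  have hk : (0 : ℝ) ≤ k := Nat.cast_nonneg k
  have h : (k : ℝ) + d - 1 ≠ 0 := by linarith
  rw [legendreDim]
  simp only [eval_sub, eval_mul, eval_C, eval_X]
  field_simp

theorem legendreDim_deriv_rec (d : ℕ) (hd : 2 ≤ d) (k : ℕ) (t : ℝ) :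
    ((k : ℝ) + d - 1) * (derivative (legendreDim d (k + 2))).eval t
      = (2 * (k : ℝ) + d) * ((legendreDim d (k + 1)).eval t
          + t * (derivative (legendreDim d (k + 1))).eval t)
        - ((k : ℝ) + 1) * (derivative (legendreDim d k)).eval t := by
  have hd' : (2 : ℝ) ≤ d := by exact_mod_cast hd
  have hk : (0 : ℝ) ≤ k := Nat.cast_nonneg k
  have h : (k : ℝ) + d - 1 ≠ 0 := by linarith
  rw [legendreDim]
  simp only [derivative_sub, derivative_mul, derivative_C, derivative_X, eval_sub, eval_add,
    eval_mul, eval_C, eval_X, eval_zero, eval_one]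
  field_simp
  ring

theorem legendreDim_structure (d : ℕ) (hd : 2 ≤ d) (t : ℝ) (k : ℕ) :
    (1 - t ^ 2) * (derivative (legendreDim d k)).eval t
      = ((k : ℝ) + d - 2) * (t * (legendreDim d k).eval t - (legendreDim d (k + 1)).eval t) := by
  have hd' : (2 : ℝ) ≤ d := by exact_mod_cast hd
  induction k using Nat.twoStepInduction with
  | zero => simp [legendreDim]
  | one =>
    have h := legendreDim_rec d hd 0 t
    simp [legendreDim] at h ⊢
    have : (d : ℝ) - 1 ≠ 0 := by linarith
    field_simp
    ring
  | more k h0 h1 =>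
    have hk : (0 : ℝ) ≤ k := Nat.cast_nonneg k
    have h : (k : ℝ) + d - 1 ≠ 0 := by linarith
    have r0 := legendreDim_rec d hd k t
    have r1 := legendreDim_rec d hd (k + 1) t
    have dr := legendreDim_deriv_rec d hd k t
    push_cast at *
    apply mul_left_cancel₀ h
    linear_combination (1 - t ^ 2) * dr + (2 * (k : ℝ) + d) * t * h1 - ((k : ℝ) + 1) * h0
      + ((k : ℝ) + d - 1) * r1 - ((k : ℝ) + d - 2) * t * r0

theorem legendreDim_shift (d : ℕ) (hd : 2 ≤ d) (t : ℝ) (k : ℕ) :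
    ((d : ℝ) - 1) * (legendreDim d (k + 1)).eval t
      = ((k : ℝ) + d) * (legendreDim (d + 2) (k + 1)).eval t
        - ((k : ℝ) + 1) * t * (legendreDim (d + 2) k).eval t := by
  have hd' : (2 : ℝ) ≤ d := by exact_mod_cast hd
  induction k using Nat.twoStepInduction with
  | zero =>
    simp [legendreDim]
    ring
  | one =>
    have r := legendreDim_rec d hd 0 t
    have q := legendreDim_rec (d + 2) (by omega) 0 t
    have l0 : ∀ e : ℕ, (legendreDim e 0).eval t = 1 := fun e => by simp [legendreDim]
    have l1 : ∀ e : ℕ, (legendreDim e 1).eval t = t := fun e => by simp [legendreDim]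
    simp only [zero_add, l0, l1] at r q
    simp only [Nat.reduceAdd, l1]
    push_cast at *
    linear_combination r - q
  | more k h0 h1 =>
    have hk : (0 : ℝ) ≤ k := Nat.cast_nonneg k
    have h : (k : ℝ) + d ≠ 0 := by linarith
    have p1 := legendreDim_rec d hd (k + 1) t
    have q0 := legendreDim_rec (d + 2) (by omega) k t
    have q1 := legendreDim_rec (d + 2) (by omega) (k + 1) t
    push_cast at *
    apply mul_left_cancel₀ h
    linear_combination ((d : ℝ) - 1) * p1 + (2 * (k : ℝ) + 2 + d) * t * h1
      - ((k : ℝ) + 2) * h0 - ((k : ℝ) + d) * q1 + ((k : ℝ) + 2) * t * q0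

/-- The Rodrigues formula. -/
theorem legendreDim_rodrigues (k d : ℕ) (hd : 2 ≤ d) (t : ℝ) (ht : t ∈ Set.Ioo (-1 : ℝ) 1) :
    (legendreDim d k).eval t
      = (-1 / 2) ^ k * (Real.Gamma (((d : ℝ) - 1) / 2) / Real.Gamma (k + ((d : ℝ) - 1) / 2))
        * (1 - t ^ 2) ^ ((3 - (d : ℝ)) / 2)
        * iteratedDeriv k (fun s : ℝ => (1 - s ^ 2) ^ ((k : ℝ) + ((d : ℝ) - 3) / 2)) t := by
  have pos : ∀ s ∈ Set.Ioo (-1 : ℝ) 1, 0 < 1 - s ^ 2 := fun s hs => by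
    nlinarith [hs.1, hs.2]
  induction k generalizing d t with
  | zero =>
    have hd' : (2 : ℝ) ≤ d := by exact_mod_cast hd
    have hG : Real.Gamma (((d : ℝ) - 1) / 2) ≠ 0 := (Real.Gamma_pos_of_pos (by linarith)).ne'
    simp only [legendreDim, eval_one, pow_zero, Nat.cast_zero, zero_add, iteratedDeriv_zero]
    rw [div_self hG, one_mul, one_mul, ← Real.rpow_add (pos t ht)]
    rw [show (3 - (d : ℝ)) / 2 + (d - 3) / 2 = 0 by ring, Real.rpow_zero]
  | succ k ih =>
    have hd' : (2 : ℝ) ≤ d := by exact_mod_cast hd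
    have hk : (0 : ℝ) ≤ k := Nat.cast_nonneg k
    have hp := pos t ht
    have hG : Real.Gamma (((d : ℝ) - 1) / 2) ≠ 0 := (Real.Gamma_pos_of_pos (by linarith)).ne'
    have hGk : Real.Gamma (k + 1 + ((d : ℝ) - 1) / 2) ≠ 0 :=
      (Real.Gamma_pos_of_pos (by linarith)).ne'
    have hGs : Real.Gamma (((d : ℝ) + 2 - 1) / 2)
        = ((d : ℝ) - 1) / 2 * Real.Gamma (((d : ℝ) - 1) / 2) := by
      rw [← Real.Gamma_add_one (by linarith)]
      congr 1
      ring
    set K : ℝ := (-1 / 2) ^ k * (((d : ℝ) - 1) / 2 * Real.Gamma (((d : ℝ) - 1) / 2)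
      / Real.Gamma (k + 1 + ((d : ℝ) - 1) / 2)) with hK
    have hK0 : K ≠ 0 := by
      have : ((d : ℝ) - 1) / 2 ≠ 0 := by linarith
      positivity
    have hfun : (fun s : ℝ => (1 - s ^ 2) ^ (((k + 1 : ℕ) : ℝ) + ((d : ℝ) - 3) / 2))
        = fun s : ℝ => (1 - s ^ 2) ^ ((k : ℝ) + (((d + 2 : ℕ) : ℝ) - 3) / 2) := by
      funext s
      congr 1
      push_cast
      ring
    have hev : iteratedDeriv k
          (fun s : ℝ => (1 - s ^ 2) ^ ((k : ℝ) + (((d + 2 : ℕ) : ℝ) - 3) / 2))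
        =ᶠ[nhds t] fun s => K⁻¹ * ((legendreDim (d + 2) k).eval s
          * (1 - s ^ 2) ^ (((d : ℝ) - 1) / 2)) := by
      filter_upwards [Ioo_mem_nhds ht.1 ht.2] with s hs
      have h := ih (d + 2) (by omega) s hs
      rw [h]
      push_cast
      rw [hGs, show (k : ℝ) + ((d : ℝ) + 2 - 1) / 2 = k + 1 + ((d : ℝ) - 1) / 2 by ring, ← hK]
      set I := iteratedDeriv k (fun s : ℝ => (1 - s ^ 2) ^ ((k : ℝ) + ((d : ℝ) + 2 - 3) / 2)) s
      have hone : (1 - s ^ 2) ^ ((3 - ((d : ℝ) + 2)) / 2) * (1 - s ^ 2) ^ (((d : ℝ) - 1) / 2)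
          = 1 := by
        rw [← Real.rpow_add (pos s hs)]
        rw [show (3 - ((d : ℝ) + 2)) / 2 + (d - 1) / 2 = 0 by ring, Real.rpow_zero]
      generalize (1 - s ^ 2) ^ ((3 - ((d : ℝ) + 2)) / 2) = A at hone ⊢
      generalize (1 - s ^ 2) ^ (((d : ℝ) - 1) / 2) = B at hone ⊢
      calc I = K⁻¹ * K * 1 * I := by rw [inv_mul_cancel₀ hK0]; ring
        _ = _ := by rw [← hone]; ring
    have hder : HasDerivAt (fun s : ℝ => K⁻¹ * ((legendreDim (d + 2) k).eval s
          * (1 - s ^ 2) ^ (((d : ℝ) - 1) / 2)))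
        (K⁻¹ * ((derivative (legendreDim (d + 2) k)).eval t * (1 - t ^ 2) ^ (((d : ℝ) - 1) / 2)
          + (legendreDim (d + 2) k).eval t
            * ((-(2 * t)) * (((d : ℝ) - 1) / 2) * (1 - t ^ 2) ^ (((d : ℝ) - 1) / 2 - 1)))) t := by
      have h1 : HasDerivAt (fun s : ℝ => 1 - s ^ 2) (-(2 * t)) t := by
        simpa using (hasDerivAt_pow 2 t).const_sub 1
      exact ((legendreDim (d + 2) k).hasDerivAt t).mul
        (h1.rpow_const (Or.inl hp.ne')) |>.const_mul _
    rw [hfun, iteratedDeriv_succ, hev.deriv_eq, hder.deriv]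
    have e1 : (1 - t ^ 2) ^ (((d : ℝ) - 1) / 2)
        = (1 - t ^ 2) ^ (((d : ℝ) - 3) / 2) * (1 - t ^ 2) := by
      rw [← Real.rpow_add_one hp.ne']
      congr 1
      ring
    have e2 : ((d : ℝ) - 1) / 2 - 1 = (d - 3) / 2 := by ring
    have e3 : (1 - t ^ 2) ^ ((3 - (d : ℝ)) / 2) * (1 - t ^ 2) ^ (((d : ℝ) - 3) / 2) = 1 := by
      rw [← Real.rpow_add hp]
      rw [show (3 - (d : ℝ)) / 2 + (d - 3) / 2 = 0 by ring, Real.rpow_zero]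
    have st := legendreDim_structure (d + 2) (by omega) t k
    have sh := legendreDim_shift d hd t k
    rw [e1, e2]
    push_cast at *
    set W := (1 - t ^ 2) ^ ((3 - (d : ℝ)) / 2)
    set V := (1 - t ^ 2) ^ (((d : ℝ) - 3) / 2)
    set G := Real.Gamma (((d : ℝ) - 1) / 2)
    set H := Real.Gamma (k + 1 + ((d : ℝ) - 1) / 2)
    have hKr : (-1 / 2 : ℝ) ^ (k + 1) * (G / H) = -K / (d - 1) := by
      have : (d : ℝ) - 1 ≠ 0 := by linarith
      rw [hK, pow_succ]
      field_simp
    have hd1 : (d : ℝ) - 1 ≠ 0 := by linarith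
    rw [hKr]
    calc (legendreDim d (k + 1)).eval t
        = (W * V) * (legendreDim d (k + 1)).eval t := by rw [e3, one_mul]
      _ = _ := by
        field_simp
        linear_combination (W * V) * (sh + st)

end

/-! With `t = cos θ`, the eigenvalue becomes the integral of `h θ = κ (cos θ)` against `P_k(cos θ)
(sin θ)^(d-2)` over `[0, π]`. For the iterates of `κ₁` this `h` is analytic up to both endpoints. If
every odd derivative of `h` vanished there, its even periodic extension would be smooth and the
integral would decay faster than any power of `k`. The decay rate is thus decided by the first odd
derivatives that survive at `0` and `π`.

The model singularities are the odd powers of `sin (θ/2)`, which is even about `π` and odd about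
`0`. Their pairings satisfy a two-term recurrence in `k`, hence are ratios of Gamma products, of
order `k^(-(j+d-1))` for the power `j`. Reflection `θ ↦ π - θ` gives the powers of `cos (θ/2)`, with
a factor `(-1)^k`. Subtracting such powers (`exists_sub_half_pow`) leaves a remainder with many
vanishing odd derivatives, and that remainder is handled by truncating its cosine series
(`exists_abs_zonalPairing_mul_pow_le`). When `h'` vanishes at both ends the outcome is
`exists_tendsto_zonalPairing`: the pairing is `K (h'''(0) - (-1)^k h'''(π)) k^(-d-2)` up to smaller
order.

It remains to compute the third derivatives. An analytic angle map `B` with `cos (B θ) = κ₁ (cos θ)`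
turns iterates of `κ₁` into `cos ∘ B^[m]`. At the fixed point `0` each layer adds `2/π` to the third
derivative, which yields linear growth in `L`. At `π`, `B` takes the value `π/2` and is flat to
second order, so the third derivative is `-2/π` times `D`, the derivative at `0` of the remaining
iterate of `κ₁`. The two constants are therefore proportional to `L - 1 + D` and `L - 1 - D`, with
`0 < D ≤ 1/2` when `L ≥ 3`. For the shallow kernel `D = 1`, and the odd constant vanishes. -/

noncomputable section

open Real intervalIntegral MeasureTheory Set

/-! ### The eigenvalue as an integral in the angle. -/

/-- The pairing `∫₀^π h(θ) P_k(cos θ) (sin θ)^{d-2} dθ`. -/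
def zonalPairing (d : ℕ) (h : ℝ → ℝ) (k : ℕ) : ℝ :=
  ∫ θ in (0 : ℝ)..π, h θ * (legendreDim d k).eval (cos θ) * sin θ ^ (d - 2)

/-- The Jacobian `sin θ` raises the real exponent `d - 3` to the natural exponent `d - 2`, so the
weight is no longer singular even for `d = 2`. Open intervals are used because the real power is
simplified with `sin θ > 0`. -/
theorem dotEigenvalue_eq_zonalPairing (d : ℕ) (hd : 2 ≤ d) (κ : ℝ → ℝ) (k : ℕ) :
    dotEigenvalue d κ k
      = sphereArea (d - 1) / sphereArea d * zonalPairing d (fun θ => κ (cos θ)) k := by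
  unfold dotEigenvalue zonalPairing
  congr 1
  have himg : cos '' Ioo 0 π = Ioo (-1) 1 := by
    ext t
    constructor
    · rintro ⟨θ, hθ, rfl⟩
      have h1 := strictAntiOn_cos (left_mem_Icc.2 pi_pos.le) (Ioo_subset_Icc_self hθ) hθ.1
      have h2 := strictAntiOn_cos (Ioo_subset_Icc_self hθ) (right_mem_Icc.2 pi_pos.le) hθ.2
      simp only [cos_zero, cos_pi] at h1 h2
      exact ⟨h2, h1⟩
    · intro ht
      refine ⟨arccos t, ⟨arccos_pos.2 ht.2, ?_⟩, cos_arccos ht.1.le ht.2.le⟩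
      exact lt_of_le_of_ne (arccos_le_pi t) fun h => by
        rw [arccos_eq_pi] at h
        exact absurd ht.1 (not_lt.2 h)
  rw [integral_of_le (by norm_num), integral_of_le pi_pos.le, integral_Ioc_eq_integral_Ioo,
    integral_Ioc_eq_integral_Ioo, ← himg,
    integral_image_eq_integral_abs_deriv_smul measurableSet_Ioo
      (fun x _ => (hasDerivAt_cos x).hasDerivWithinAt)
      (injOn_cos.mono Ioo_subset_Icc_self)]
  refine setIntegral_congr_fun measurableSet_Ioo fun θ hθ => ?_
  have hs : 0 < sin θ := sin_pos_of_mem_Ioo hθ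
  have h1 : (1 - cos θ ^ 2) ^ (((d : ℝ) - 3) / 2) = sin θ ^ ((d : ℝ) - 3) := by
    rw [← sin_sq, ← rpow_natCast (sin θ) 2, ← rpow_mul hs.le]
    congr 1
    push_cast
    ring
  have h2 : sin θ * sin θ ^ ((d : ℝ) - 3) = sin θ ^ (d - 2) := by
    nth_rewrite 1 [← rpow_one (sin θ)]
    rw [← rpow_natCast, ← rpow_add hs, Nat.cast_sub hd]
    congr 1
    push_cast
    ring
  simp only [abs_neg, abs_of_pos hs, smul_eq_mul, h1, ← h2]
  ring

theorem zonalPairing_congr {d : ℕ} {f g : ℝ → ℝ} (h : ∀ θ ∈ Icc 0 π, f θ = g θ) (k : ℕ) :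
    zonalPairing d f k = zonalPairing d g k := by
  refine integral_congr fun θ hθ => ?_
  rw [uIcc_of_le pi_pos.le] at hθ
  simp only [h θ hθ]

theorem continuousOn_zonal {h : ℝ → ℝ} (hh : ContinuousOn h (Icc 0 π)) (p : ℝ[X]) (n : ℕ) :
    ContinuousOn (fun θ => h θ * p.eval (cos θ) * sin θ ^ n) (uIcc 0 π) := by
  rw [uIcc_of_le pi_pos.le]
  have h1 : Continuous fun θ : ℝ => p.eval (cos θ) := p.continuous.comp continuous_cos
  exact (hh.mul h1.continuousOn).mul (continuous_sin.pow n).continuousOn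

theorem intervalIntegrable_zonal {h : ℝ → ℝ} (hh : ContinuousOn h (Icc 0 π)) (p : ℝ[X]) (n : ℕ) :
    IntervalIntegrable (fun θ => h θ * p.eval (cos θ) * sin θ ^ n) volume 0 π :=
  (continuousOn_zonal hh p n).intervalIntegrable

theorem zonalPairing_add {d : ℕ} {f g : ℝ → ℝ} (hf : ContinuousOn f (Icc 0 π))
    (hg : ContinuousOn g (Icc 0 π)) (k : ℕ) :
    zonalPairing d (fun θ => f θ + g θ) k = zonalPairing d f k + zonalPairing d g k := by
  unfold zonalPairing
  rw [← integral_add (intervalIntegrable_zonal hf _ _) (intervalIntegrable_zonal hg _ _)]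
  simp only [add_mul]

theorem zonalPairing_const_mul (d : ℕ) (c : ℝ) (f : ℝ → ℝ) (k : ℕ) :
    zonalPairing d (fun θ => c * f θ) k = c * zonalPairing d f k := by
  unfold zonalPairing
  rw [← intervalIntegral.integral_const_mul]
  simp only [mul_assoc]

theorem zonalPairing_sub {d : ℕ} {f g : ℝ → ℝ} (hf : ContinuousOn f (Icc 0 π))
    (hg : ContinuousOn g (Icc 0 π)) (k : ℕ) :
    zonalPairing d (fun θ => f θ - g θ) k = zonalPairing d f k - zonalPairing d g k := by
  unfold zonalPairing
  rw [← integral_sub (intervalIntegrable_zonal hf _ _) (intervalIntegrable_zonal hg _ _)]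
  simp only [sub_mul]

theorem zonalPairing_rec (d : ℕ) (hd : 2 ≤ d) {h : ℝ → ℝ} (hh : ContinuousOn h (Icc 0 π))
    (k : ℕ) :
    ((k : ℝ) + d - 1) * zonalPairing d h (k + 2)
      = (2 * (k : ℝ) + d) * zonalPairing d (fun θ => h θ * cos θ) (k + 1)
        - ((k : ℝ) + 1) * zonalPairing d h k := by
  have hc : ContinuousOn (fun θ => h θ * cos θ) (Icc 0 π) := hh.mul continuous_cos.continuousOn
  simp only [zonalPairing]
  rw [← intervalIntegral.integral_const_mul, ← intervalIntegral.integral_const_mul,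
    ← intervalIntegral.integral_const_mul, ← integral_sub
      ((intervalIntegrable_zonal hc _ _).const_mul _) ((intervalIntegrable_zonal hh _ _).const_mul _)]
  refine integral_congr fun θ _ => ?_
  linear_combination h θ * sin θ ^ (d - 2) * legendreDim_rec d hd k (cos θ)

theorem legendreDim_eval_neg (d k : ℕ) (t : ℝ) :
    (legendreDim d k).eval (-t) = (-1) ^ k * (legendreDim d k).eval t := by
  induction k using Nat.twoStepInduction with
  | zero => simp [legendreDim]
  | one => simp [legendreDim]
  | more k h0 h1 =>
    simp only [legendreDim, eval_sub, eval_mul, eval_C, eval_X, h0, h1]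
    ring

theorem zonalPairing_reflect (d : ℕ) (h : ℝ → ℝ) (k : ℕ) :
    zonalPairing d (fun θ => h (π - θ)) k = (-1) ^ k * zonalPairing d h k := by
  unfold zonalPairing
  have := intervalIntegral.integral_comp_sub_left (a := 0) (b := π)
    (fun θ => h (π - θ) * (legendreDim d k).eval (cos θ) * sin θ ^ (d - 2)) π
  simp only [sub_self, sub_zero, sub_sub_cancel, cos_pi_sub, sin_pi_sub,
    legendreDim_eval_neg] at this
  rw [← this, ← intervalIntegral.integral_const_mul]
  refine integral_congr fun θ _ => ?_
  ring

/-! ### Half-angle powers, and orthogonality to polynomials of lower degree. -/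

theorem hasDerivAt_sin_half_pow (j : ℕ) (θ : ℝ) :
    HasDerivAt (fun θ => sin (θ / 2) ^ j) (j * sin (θ / 2) ^ (j - 1) * (cos (θ / 2) / 2)) θ := by
  have h := ((hasDerivAt_id θ).div_const 2).sin.pow j
  simp only [id] at h
  refine h.congr_deriv ?_
  ring

theorem continuous_sin_half_pow (j : ℕ) : Continuous fun θ : ℝ => sin (θ / 2) ^ j := by
  fun_prop

/-- The derivative of `sin(θ/2)^j P_k(cos θ) sin(θ)^(d-1)` integrates to zero, since `sin` vanishes
at both ends. `legendreDim_structure` removes the derivative of `P_k`, and the half-angle formulas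
reduce the other derivative to `sin(θ/2)^j (1 + cos θ)`. -/
theorem zonalPairing_sin_half_pow_structure (d : ℕ) (hd : 2 ≤ d) (j k : ℕ) :
    ((k : ℝ) - j / 2 - 1) * zonalPairing d (fun θ => sin (θ / 2) ^ j * cos θ) k
      = (j / 2 : ℝ) * zonalPairing d (fun θ => sin (θ / 2) ^ j) k
        + ((k : ℝ) + d - 2) * zonalPairing d (fun θ => sin (θ / 2) ^ j) (k + 1) := by
  have hder : ∀ θ ∈ uIcc 0 π, HasDerivAt
      (fun θ => sin (θ / 2) ^ j * (legendreDim d k).eval (cos θ) * sin θ ^ (d - 1))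
      ((j / 2 : ℝ) * (sin (θ / 2) ^ j * (legendreDim d k).eval (cos θ) * sin θ ^ (d - 2))
        + ((k : ℝ) + d - 2)
          * (sin (θ / 2) ^ j * (legendreDim d (k + 1)).eval (cos θ) * sin θ ^ (d - 2))
        - ((k : ℝ) - j / 2 - 1)
          * (sin (θ / 2) ^ j * cos θ * (legendreDim d k).eval (cos θ) * sin θ ^ (d - 2))) θ := by
    intro θ _
    have hP : HasDerivAt (fun θ => (legendreDim d k).eval (cos θ))
        ((derivative (legendreDim d k)).eval (cos θ) * (-sin θ)) θ :=
      ((legendreDim d k).hasDerivAt (cos θ)).comp θ (hasDerivAt_cos θ)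
    have h := ((hasDerivAt_sin_half_pow j θ).mul hP).mul ((hasDerivAt_sin θ).pow (d - 1))
    refine h.congr_deriv ?_
    have hst := legendreDim_structure d hd (cos θ) k
    obtain ⟨e, rfl⟩ := Nat.exists_eq_add_of_le hd
    have h2 : (j : ℝ) * sin (θ / 2) ^ (j - 1) * (cos (θ / 2) / 2) * sin θ
        = j / 2 * sin (θ / 2) ^ j * (1 + cos θ) := by
      have hs : sin θ = 2 * sin (θ / 2) * cos (θ / 2) := by
        rw [← sin_two_mul]
        ring_nf
      have hc : cos θ = 2 * cos (θ / 2) ^ 2 - 1 := by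
        rw [← cos_two_mul]
        ring_nf
      rw [hs, hc]
      cases j with
      | zero => simp
      | succ j =>
        rw [Nat.add_sub_cancel]
        ring
    have hsq := sin_sq_add_cos_sq θ
    simp only [show 2 + e - 1 = e + 1 by omega, show 2 + e - 2 = e by omega,
      Nat.add_sub_cancel]
    push_cast at hst ⊢
    simp only [Pi.mul_apply, Pi.pow_apply]
    set S := sin (θ / 2) ^ j
    set P := (legendreDim (2 + e) k).eval (cos θ)
    set Q := (legendreDim (2 + e) (k + 1)).eval (cos θ)
    set D := (derivative (legendreDim (2 + e) k)).eval (cos θ)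
    linear_combination P * sin θ ^ e * h2 - S * sin θ ^ e * hst - S * D * sin θ ^ e * hsq
  have hc := continuous_sin_half_pow j
  have hc' : Continuous fun θ : ℝ => sin (θ / 2) ^ j * cos θ := by fun_prop
  have i1 := intervalIntegrable_zonal hc.continuousOn (legendreDim d k) (d - 2)
  have i2 := intervalIntegrable_zonal hc.continuousOn (legendreDim d (k + 1)) (d - 2)
  have i3 := intervalIntegrable_zonal hc'.continuousOn (legendreDim d k) (d - 2)
  have := integral_eq_sub_of_hasDerivAt hder
    (((i1.const_mul _).add (i2.const_mul _)).sub (i3.const_mul _))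
  rw [integral_sub ((i1.const_mul _).add (i2.const_mul _)) (i3.const_mul _),
    integral_add (i1.const_mul _) (i2.const_mul _), intervalIntegral.integral_const_mul,
    intervalIntegral.integral_const_mul, intervalIntegral.integral_const_mul, sin_pi, sin_zero,
    zero_pow (by omega)] at this
  simp only [zonalPairing]
  linarith

/-- Eliminating the pairing with the extra factor `cos θ` between the structure relation and the
three-term recurrence leaves, by induction, only two consecutive degrees. -/
theorem zonalPairing_sin_half_pow_succ (d : ℕ) (hd : 2 ≤ d) (j k : ℕ) :
    ((k : ℝ) + d - 1 + j / 2) * zonalPairing d (fun θ => sin (θ / 2) ^ j) (k + 1)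
      = ((k : ℝ) - j / 2) * zonalPairing d (fun θ => sin (θ / 2) ^ j) k := by
  have hd' : (2 : ℝ) ≤ d := by exact_mod_cast hd
  induction k with
  | zero =>
    have h := zonalPairing_sin_half_pow_structure d hd j 0
    have h1 : zonalPairing d (fun θ => sin (θ / 2) ^ j * cos θ) 0
        = zonalPairing d (fun θ => sin (θ / 2) ^ j) 1 := by
      simp [zonalPairing, legendreDim]
    rw [h1] at h
    push_cast at *
    linear_combination -h
  | succ k ih =>
    have h := zonalPairing_sin_half_pow_structure d hd j (k + 1)
    have r := zonalPairing_rec d hd (continuous_sin_half_pow j).continuousOn k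
    have hk : (0 : ℝ) ≤ k := Nat.cast_nonneg k
    have h0 : (k : ℝ) + d - 1 ≠ 0 := by linarith
    push_cast at *
    apply mul_left_cancel₀ h0
    linear_combination -(2 * (k : ℝ) + d) * h - ((k : ℝ) - j / 2) * r - ((k : ℝ) + 1) * ih

theorem zonalPairing_one (d : ℕ) (hd : 2 ≤ d) (k : ℕ) :
    zonalPairing d (fun _ => 1) (k + 1) = 0 := by
  have hd' : (2 : ℝ) ≤ d := by exact_mod_cast hd
  induction k with
  | zero =>
    have h := zonalPairing_sin_half_pow_succ d hd 0 0
    simp at h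
    rcases h with h | h
    · linarith
    · simpa using h
  | succ k ih =>
    have h := zonalPairing_sin_half_pow_succ d hd 0 (k + 1)
    have hk : (0 : ℝ) ≤ k := Nat.cast_nonneg k
    simp [ih] at h
    rcases h with h | h
    · linarith
    · simpa using h

/-- The three-term recurrence, read backwards, expresses a pairing with an extra factor `cos θ`
through the pairings in the two neighbouring degrees. -/
theorem zonalPairing_cos_pow (d : ℕ) (hd : 2 ≤ d) {n k : ℕ} (hnk : n < k) :
    zonalPairing d (fun θ => cos θ ^ n) k = 0 := by
  have hd' : (2 : ℝ) ≤ d := by exact_mod_cast hd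
  induction n generalizing k with
  | zero =>
    obtain ⟨k, rfl⟩ := Nat.exists_eq_succ_of_ne_zero hnk.ne'
    simpa using zonalPairing_one d hd k
  | succ n ih =>
    obtain ⟨k, rfl⟩ := Nat.exists_eq_succ_of_ne_zero (show k ≠ 0 by omega)
    have r := zonalPairing_rec d hd (h := fun θ => cos θ ^ n)
      (continuous_cos.pow n).continuousOn k
    have hk : (0 : ℝ) ≤ k := Nat.cast_nonneg k
    have h0 : 2 * (k : ℝ) + d ≠ 0 := by linarith
    rw [ih (show n < k by omega), ih (show n < k + 2 by omega)] at r
    simp only [← pow_succ] at r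
    apply mul_left_cancel₀ h0
    linarith

theorem zonalPairing_eval_cos (d : ℕ) (hd : 2 ≤ d) {p : ℝ[X]} {k : ℕ} (hp : p.natDegree < k) :
    zonalPairing d (fun θ => p.eval (cos θ)) k = 0 := by
  have hsum : zonalPairing d (fun θ => p.eval (cos θ)) k
      = ∑ n ∈ Finset.range (p.natDegree + 1),
        p.coeff n * zonalPairing d (fun θ => cos θ ^ n) k := by
    unfold zonalPairing
    simp only [← intervalIntegral.integral_const_mul]
    rw [← intervalIntegral.integral_finsetSum]
    · refine integral_congr fun θ _ => ?_
      rw [eval_eq_sum_range, Finset.sum_mul, Finset.sum_mul]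
      simp only [mul_assoc]
    · intro n _
      exact (intervalIntegrable_zonal (continuous_cos.pow n).continuousOn _ _).const_mul _
  rw [hsum]
  refine Finset.sum_eq_zero fun n hn => ?_
  rw [zonalPairing_cos_pow d hd (by have := Finset.mem_range.1 hn; omega), mul_zero]

theorem zonalPairing_cos_nat_mul (d : ℕ) (hd : 2 ≤ d) {n k : ℕ} (hnk : n < k) :
    zonalPairing d (fun θ => cos (n * θ)) k = 0 := by
  have h := zonalPairing_eval_cos d hd (p := Chebyshev.T ℝ n) (k := k)
    (by rw [Chebyshev.natDegree_T]; simpa using hnk)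
  simpa [Chebyshev.T_real_cos] using h

/-! ### A bound for the pairing by the sup norm, uniform in the degree. -/

theorem natDegree_legendreDim_le (d k : ℕ) : (legendreDim d k).natDegree ≤ k := by
  induction k using Nat.twoStepInduction with
  | zero => simp [legendreDim]
  | one => simp [legendreDim]
  | more k h0 h1 =>
    rw [legendreDim]
    refine (natDegree_sub_le _ _).trans (max_le ?_ ?_)
    · refine natDegree_mul_le.trans ?_
      have : (C ((2 * (k : ℝ) + d) / ((k : ℝ) + d - 1)) * X : ℝ[X]).natDegree ≤ 1 :=
        (natDegree_C_mul_le _ _).trans natDegree_X_le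
      omega
    · exact (natDegree_C_mul_le _ _).trans (by omega)

theorem continuous_eval_cos (p : ℝ[X]) : Continuous fun θ : ℝ => p.eval (cos θ) :=
  p.continuous.comp continuous_cos

theorem zonalPairing_legendreDim_comm (d m k : ℕ) :
    zonalPairing d (fun θ => (legendreDim d m).eval (cos θ)) k
      = zonalPairing d (fun θ => (legendreDim d k).eval (cos θ)) m :=
  integral_congr fun θ _ => by ring

/-- Computing the integral of `P_(k+1) P_(k+2) cos θ` from two instances of the recurrence gives the
exact ratio of consecutive squared norms, `(2k+d)(k+2) / ((k+d-1)(2k+2+d))`. It is at most `1`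
because denominator minus numerator is `(d-2)(2k+d+1)`. -/
theorem zonalPairing_self_succ_le (d : ℕ) (hd : 2 ≤ d) (k : ℕ) :
    zonalPairing d (fun θ => (legendreDim d (k + 2)).eval (cos θ)) (k + 2)
      ≤ zonalPairing d (fun θ => (legendreDim d (k + 1)).eval (cos θ)) (k + 1) := by
  have hd' : (2 : ℝ) ≤ d := by exact_mod_cast hd
  have hk : (0 : ℝ) ≤ k := Nat.cast_nonneg k
  have r0 := zonalPairing_rec d hd (continuous_eval_cos (legendreDim d (k + 2))).continuousOn k
  have r1 := zonalPairing_rec d hd (continuous_eval_cos (legendreDim d (k + 1))).continuousOn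
    (k + 1)
  rw [zonalPairing_legendreDim_comm d (k + 2) k, zonalPairing_eval_cos d hd
    (lt_of_le_of_lt (natDegree_legendreDim_le d k) (by omega))] at r0
  rw [zonalPairing_eval_cos d hd
    (lt_of_le_of_lt (natDegree_legendreDim_le d (k + 1)) (by omega))] at r1
  have hx : zonalPairing d (fun θ => (legendreDim d (k + 2)).eval (cos θ) * cos θ) (k + 1)
      = zonalPairing d (fun θ => (legendreDim d (k + 1)).eval (cos θ) * cos θ) (k + 2) :=
    integral_congr fun θ _ => by ring
  have hN : 0 ≤ zonalPairing d (fun θ => (legendreDim d (k + 1)).eval (cos θ)) (k + 1) := by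
    refine intervalIntegral.integral_nonneg pi_pos.le fun θ hθ => ?_
    have := sin_nonneg_of_mem_Icc hθ
    have := mul_self_nonneg ((legendreDim d (k + 1)).eval (cos θ))
    positivity
  rw [hx] at r0
  push_cast at r1
  set M := zonalPairing d (fun θ => (legendreDim d (k + 2)).eval (cos θ)) (k + 2)
  set N := zonalPairing d (fun θ => (legendreDim d (k + 1)).eval (cos θ)) (k + 1)
  set T := zonalPairing d (fun θ => (legendreDim d (k + 1)).eval (cos θ) * cos θ) (k + 2)
  have hpos : 0 < ((k : ℝ) + d - 1) * (2 * k + 2 + d) := by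
    apply mul_pos <;> linarith
  refine le_of_mul_le_mul_left ?_ hpos
  have e : ((k : ℝ) + d - 1) * (2 * k + 2 + d) * M = (2 * k + d) * (k + 2) * N := by
    linear_combination (2 * (k : ℝ) + 2 + d) * r0 - (2 * (k : ℝ) + d) * r1
  rw [e]
  refine mul_le_mul_of_nonneg_right ?_ hN
  nlinarith [mul_nonneg hk (sub_nonneg.2 hd'), mul_nonneg (sub_nonneg.2 hd') (sub_nonneg.2 hd')]

theorem exists_abs_zonalPairing_le (d : ℕ) (hd : 2 ≤ d) :
    ∃ C : ℝ, 0 ≤ C ∧ ∀ (h : ℝ → ℝ) (b : ℝ) (k : ℕ), 1 ≤ k → (∀ θ ∈ Icc 0 π, |h θ| ≤ b) →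
      |zonalPairing d h k| ≤ C * b := by
  set N : ℕ → ℝ := fun k => zonalPairing d (fun θ => (legendreDim d k).eval (cos θ)) k with hNdef
  set A : ℝ := ∫ θ in (0 : ℝ)..π, sin θ ^ (d - 2) with hA
  have hN : ∀ k, N (k + 1) ≤ N 1 := fun k => by
    induction k with
    | zero => rfl
    | succ k ih => exact (zonalPairing_self_succ_le d hd k).trans ih
  have hsin : ∀ θ ∈ Icc 0 π, 0 ≤ sin θ ^ (d - 2) := fun θ hθ =>
    pow_nonneg (sin_nonneg_of_mem_Icc hθ) _
  have hN1 : 0 ≤ N 1 := intervalIntegral.integral_nonneg pi_pos.le fun θ hθ =>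
    mul_nonneg (mul_self_nonneg _) (hsin θ hθ)
  have hA0 : 0 ≤ A := intervalIntegral.integral_nonneg pi_pos.le hsin
  refine ⟨A + N 1, by positivity, fun h b k hk hb => ?_⟩
  obtain ⟨k, rfl⟩ := Nat.exists_eq_succ_of_ne_zero (show k ≠ 0 by omega)
  have hb0 : 0 ≤ b := (abs_nonneg _).trans (hb 0 (left_mem_Icc.2 pi_pos.le))
  have i1 : IntervalIntegrable (fun θ : ℝ => sin θ ^ (d - 2)) volume 0 π :=
    (continuous_sin.pow _).intervalIntegrable _ _
  have i2 := intervalIntegrable_zonal (continuous_eval_cos (legendreDim d (k + 1))).continuousOn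
    (legendreDim d (k + 1)) (d - 2)
  have hle : |zonalPairing d h (k + 1)| ≤ ∫ θ in (0 : ℝ)..π, b * (sin θ ^ (d - 2)
      + (legendreDim d (k + 1)).eval (cos θ) * (legendreDim d (k + 1)).eval (cos θ)
        * sin θ ^ (d - 2)) := by
    rw [← norm_eq_abs]
    refine intervalIntegral.norm_integral_le_of_norm_le pi_pos.le
      (Eventually.of_forall fun θ hθ => ?_) ((i1.add i2).const_mul b)
    have hθ' := Ioc_subset_Icc_self hθ
    have hs := hsin θ hθ'
    set P := (legendreDim d (k + 1)).eval (cos θ)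
    rw [norm_eq_abs, abs_mul, abs_mul, abs_of_nonneg hs]
    -- This replaces the pointwise bound of `P_k` by `1`: monotonicity of the squared norms
    -- suffices.
    have hP : |P| ≤ 1 + P * P := by
      rw [← abs_mul_abs_self P]
      nlinarith [sq_nonneg (|P| - 1), abs_nonneg P]
    calc |h θ| * |P| * sin θ ^ (d - 2) ≤ b * (1 + P * P) * sin θ ^ (d - 2) := by
          have := hb θ hθ'
          gcongr
      _ = _ := by ring
  rw [intervalIntegral.integral_const_mul, integral_add i1 i2] at hle
  refine hle.trans ?_
  rw [mul_comm]
  refine mul_le_mul_of_nonneg_right ?_ hb0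
  exact add_le_add_right (hN k) A

/-! ### Asymptotics of the half-angle powers. -/

theorem zonalPairing_sin_half_pow_eq_prod (d : ℕ) (hd : 2 ≤ d) (j k : ℕ) :
    zonalPairing d (fun θ => sin (θ / 2) ^ j) k * ∏ i ∈ Finset.range k, ((d - 1 + j / 2 : ℝ) + i)
      = zonalPairing d (fun θ => sin (θ / 2) ^ j) 0
        * ∏ i ∈ Finset.range k, (-(j / 2 : ℝ) + i) := by
  induction k with
  | zero => simp
  | succ k ih =>
    rw [Finset.prod_range_succ, Finset.prod_range_succ, ← mul_assoc _ _ (-(j / 2 : ℝ) + k), ← ih]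
    linear_combination (∏ i ∈ Finset.range k, ((d - 1 + j / 2 : ℝ) + i))
      * zonalPairing_sin_half_pow_succ d hd j k

/-- The two products are the denominators in Euler's limit for `Gamma`, so the pairing is a quotient
of two `GammaSeq` terms. Oddness of `j` keeps `-j/2` away from the poles. -/
theorem tendsto_zonalPairing_sin_half_pow (d : ℕ) (hd : 2 ≤ d) (j : ℕ) (hj : Odd j) :
    Tendsto (fun k : ℕ => zonalPairing d (fun θ => sin (θ / 2) ^ j) k * (k : ℝ) ^ (j + d - 1 : ℕ))
      atTop (nhds (zonalPairing d (fun θ => sin (θ / 2) ^ j) 0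
        * (Gamma (d - 1 + j / 2) / Gamma (-(j / 2))))) := by
  have hd' : (2 : ℝ) ≤ d := by exact_mod_cast hd
  have hne : ∀ i : ℕ, -(j / 2 : ℝ) + i ≠ 0 := fun i h => by
    have : (j : ℝ) = (2 * i : ℕ) := by push_cast; linarith
    have : j = 2 * i := by exact_mod_cast this
    obtain ⟨m, rfl⟩ := hj
    omega
  have hG : Gamma (-(j / 2 : ℝ)) ≠ 0 := Gamma_ne_zero fun m h => hne m (by rw [h]; ring)
  have hpos : ∀ i : ℕ, (0 : ℝ) < (d - 1 + j / 2 : ℝ) + i := fun i => by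
    have : (0 : ℝ) ≤ j / 2 := by positivity
    have : (0 : ℝ) ≤ i := by positivity
    linarith
  -- `GammaSeq s n` has `n + 1` factors in its denominator, so it matches degree `n + 1`; the limit
  -- in `h1` repairs the change from `n` to `n + 1` in the power.
  rw [← tendsto_add_atTop_iff_nat 1]
  have h1 : Tendsto (fun n : ℕ => (((n + 1 : ℕ) : ℝ) / n) ^ (j + d - 1 : ℕ)) atTop (nhds 1) := by
    have : Tendsto (fun n : ℕ => ((n + 1 : ℕ) : ℝ) / n) atTop (nhds 1) := by
      have h := (tendsto_natCast_div_add_atTop (1 : ℝ)).inv₀ one_ne_zero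
      simpa [inv_div] using h
    simpa using this.pow (j + d - 1)
  have h2 := ((GammaSeq_tendsto_Gamma (d - 1 + j / 2)).div
    (GammaSeq_tendsto_Gamma (-(j / 2))) hG).const_mul
      (zonalPairing d (fun θ => sin (θ / 2) ^ j) 0)
  have h3 := h2.mul h1
  rw [mul_one] at h3
  refine h3.congr' ?_
  filter_upwards [eventually_gt_atTop 0] with n hn
  have hn' : (0 : ℝ) < n := by exact_mod_cast hn
  have hp := zonalPairing_sin_half_pow_eq_prod d hd j (n + 1)
  have hB : (0 : ℝ) < ∏ i ∈ Finset.range (n + 1), ((d - 1 + j / 2 : ℝ) + i) :=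
    Finset.prod_pos fun i _ => hpos i
  have hA : ∏ i ∈ Finset.range (n + 1), (-(j / 2 : ℝ) + i) ≠ 0 :=
    Finset.prod_ne_zero_iff.2 fun i _ => hne i
  have hpow : (n : ℝ) ^ (d - 1 + j / 2 : ℝ) = (n : ℝ) ^ (-(j / 2) : ℝ) * (n : ℝ) ^ (j + d - 1) := by
    rw [← rpow_natCast (n : ℝ) (j + d - 1), ← rpow_add hn', Nat.cast_sub (by omega)]
    congr 1
    push_cast
    ring
  have hr : (n : ℝ) ^ (-(j / 2) : ℝ) ≠ 0 := (rpow_pos_of_pos hn' _).ne'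
  simp only [Pi.div_apply, GammaSeq]
  rw [hpow, div_pow]
  set A := ∏ i ∈ Finset.range (n + 1), (-(j / 2 : ℝ) + i)
  set B := ∏ i ∈ Finset.range (n + 1), ((d - 1 + j / 2 : ℝ) + i)
  have hI : zonalPairing d (fun θ => sin (θ / 2) ^ j) (n + 1)
      = zonalPairing d (fun θ => sin (θ / 2) ^ j) 0 * A / B := by
    rw [← hp, mul_div_cancel_right₀ _ hB.ne']
  rw [hI]
  have hf : ((n.factorial : ℕ) : ℝ) ≠ 0 := by exact_mod_cast n.factorial_ne_zero
  field_simp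

theorem exists_pos_tendsto_zonalPairing_sin_half_cube (d : ℕ) (hd : 2 ≤ d) :
    ∃ c : ℝ, 0 < c ∧ Tendsto (fun k : ℕ =>
      zonalPairing d (fun θ => sin (θ / 2) ^ 3) k * (k : ℝ) ^ (d + 2)) atTop (nhds c) := by
  have hd' : (2 : ℝ) ≤ d := by exact_mod_cast hd
  have h := tendsto_zonalPairing_sin_half_pow d hd 3 (by decide)
  rw [show 3 + d - 1 = d + 2 by omega] at h
  refine ⟨_, ?_, h⟩
  -- Two steps of the functional equation from `Gamma (1/2) > 0` pass two negative factors, so the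
  -- sign is positive again.
  have hG : 0 < Gamma (-((3 : ℕ) / 2 : ℝ)) := by
    have h1 := Gamma_add_one (s := -1 / 2) (by norm_num)
    have h2 := Gamma_add_one (s := -3 / 2) (by norm_num)
    have h3 : 0 < Gamma (-1 / 2 + 1) := Gamma_pos_of_pos (by norm_num)
    rw [show (-3 / 2 + 1 : ℝ) = -1 / 2 by norm_num] at h2
    rw [show (-((3 : ℕ) / 2) : ℝ) = -3 / 2 by norm_num]
    nlinarith
  have hG' : 0 < Gamma ((d : ℝ) - 1 + (3 : ℕ) / 2) := Gamma_pos_of_pos (by push_cast; linarith)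
  have hI : 0 < zonalPairing d (fun θ => sin (θ / 2) ^ 3) 0 := by
    refine intervalIntegral.intervalIntegral_pos_of_pos_on
      (intervalIntegrable_zonal (continuous_sin_half_pow 3).continuousOn _ _) (fun θ hθ => ?_)
      pi_pos
    have h1 := sin_pos_of_mem_Ioo hθ
    have h2 : 0 < sin (θ / 2) := sin_pos_of_pos_of_lt_pi (by linarith [hθ.1]) (by
      linarith [hθ.2, pi_pos])
    simp only [legendreDim, eval_one]
    positivity
  positivity

/-! ### Cosine series and fast decay when odd derivatives vanish at the endpoints. -/

theorem sq_mul_integral_mul_cos {R : ℝ → ℝ} (hR : AnalyticOnNhd ℝ R (Icc 0 π))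
    (h0 : deriv R 0 = 0) (hπ : deriv R π = 0) (n : ℤ) :
    (n : ℝ) ^ 2 * ∫ θ in (0 : ℝ)..π, R θ * cos (n * θ)
      = -∫ θ in (0 : ℝ)..π, deriv^[2] R θ * cos (n * θ) := by
  have hu : uIcc 0 π = Icc 0 π := uIcc_of_le pi_pos.le
  have hc : ∀ f : ℝ → ℝ, AnalyticOnNhd ℝ f (Icc 0 π) →
      IntervalIntegrable (fun θ => f θ * cos (n * θ)) volume 0 π := fun f hf => by
    refine ContinuousOn.intervalIntegrable ?_
    rw [hu]
    exact hf.continuousOn.mul (by fun_prop)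
  -- Two integrations by parts at once: the boundary terms contain `R'` or `sin (n θ)`, both zero at
  -- `0` and `π`.
  have hder : ∀ θ ∈ uIcc 0 π, HasDerivAt
      (fun θ => deriv R θ * cos (n * θ) + n * (R θ * sin (n * θ)))
      (deriv^[2] R θ * cos (n * θ) + (n : ℝ) ^ 2 * (R θ * cos (n * θ))) θ := by
    intro θ hθ
    rw [hu] at hθ
    have h1 := (hR.deriv θ hθ).differentiableAt.hasDerivAt
    have h2 := (hR θ hθ).differentiableAt.hasDerivAt
    have h3 : HasDerivAt (fun θ : ℝ => (n : ℝ) * θ) n θ := by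
      simpa using (hasDerivAt_id θ).const_mul (n : ℝ)
    refine ((h1.mul h3.cos).add ((h2.mul h3.sin).const_mul (n : ℝ))).congr_deriv ?_
    simp only [Function.iterate_succ, Function.iterate_zero, Function.comp_apply, id]
    ring
  have i1 := hc _ (hR.iterated_deriv 2)
  have i2 := (hc _ hR).const_mul ((n : ℝ) ^ 2)
  have h := integral_eq_sub_of_hasDerivAt hder (i1.add i2)
  rw [integral_add i1 i2, intervalIntegral.integral_const_mul, h0, hπ] at h
  simp only [zero_mul, mul_zero, sin_zero, sin_int_mul_pi, add_zero, sub_zero] at h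
  linarith

theorem pow_mul_integral_mul_cos (M : ℕ) {R : ℝ → ℝ} (hR : AnalyticOnNhd ℝ R (Icc 0 π))
    (h0 : ∀ i < M, deriv^[2 * i + 1] R 0 = 0) (hπ : ∀ i < M, deriv^[2 * i + 1] R π = 0)
    (n : ℤ) :
    (n : ℝ) ^ (2 * M) * ∫ θ in (0 : ℝ)..π, R θ * cos (n * θ)
      = (-1) ^ M * ∫ θ in (0 : ℝ)..π, deriv^[2 * M] R θ * cos (n * θ) := by
  induction M with
  | zero => simp
  | succ M ih =>
    have ih := ih (fun i hi => h0 i (by omega)) (fun i hi => hπ i (by omega))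
    have h := sq_mul_integral_mul_cos (hR.iterated_deriv (2 * M))
      (by simpa only [Function.iterate_succ_apply'] using h0 M M.lt_succ_self)
      (by simpa only [Function.iterate_succ_apply'] using hπ M M.lt_succ_self) n
    rw [← Function.iterate_add_apply, add_comm 2 (2 * M)] at h
    rw [show 2 * (M + 1) = 2 * M + 2 by ring, pow_add, pow_succ]
    linear_combination (n : ℝ) ^ 2 * ih + (-1) ^ M * h

theorem hasSum_cosine_series {R : ℝ → ℝ} (hR : ContinuousOn R (Icc 0 π))
    (hs : Summable fun n : ℤ => ∫ θ in (0 : ℝ)..π, R θ * cos (n * θ)) {θ : ℝ}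
    (hθ : θ ∈ Icc 0 π) :
    HasSum (fun n : ℤ => π⁻¹ * (∫ θ in (0 : ℝ)..π, R θ * cos (n * θ)) * cos (n * θ)) (R θ) := by
  have : Fact (0 < 2 * π) := ⟨two_pi_pos⟩
  -- Composing with `arccos ∘ cos` is the even `2π`-periodic extension, continuous without any
  -- matching condition.
  have hF : Continuous fun x : AddCircle (2 * π) => (R (arccos (Real.Angle.cos x)) : ℂ) := by
    refine Complex.continuous_ofReal.comp (hR.comp_continuous ?_ ?_)
    · exact continuous_arccos.comp Real.Angle.continuous_cos
    · exact fun x => ⟨arccos_nonneg _, arccos_le_pi _⟩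
  set F : C(AddCircle (2 * π), ℂ) := ⟨_, hF⟩ with hFdef
  have hFx : ∀ x ∈ Icc 0 π, F (x : AddCircle (2 * π)) = (R x : ℂ) := fun x hx => by
    have : Real.Angle.cos (x : AddCircle (2 * π)) = cos x := Real.Angle.cos_coe x
    simp only [hFdef, ContinuousMap.coe_mk, this, arccos_cos hx.1 hx.2]
  have hFn : ∀ x ∈ Icc 0 π, F ((-x : ℝ) : AddCircle (2 * π)) = (R x : ℂ) := fun x hx => by
    have : Real.Angle.cos ((-x : ℝ) : AddCircle (2 * π)) = cos (-x) := Real.Angle.cos_coe (-x)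
    simp only [hFdef, ContinuousMap.coe_mk, this, cos_neg, arccos_cos hx.1 hx.2]
  have hfour : ∀ (n : ℤ) (x : ℝ), fourier n (x : AddCircle (2 * π))
      = Complex.exp ((n * x : ℝ) * Complex.I) := fun n x => by
    rw [fourier_coe_apply]
    congr 1
    have : (π : ℂ) ≠ 0 := by exact_mod_cast pi_ne_zero
    push_cast
    field_simp
  have hcoeff : ∀ n : ℤ, fourierCoeff F n
      = ((π⁻¹ * ∫ θ in (0 : ℝ)..π, R θ * cos (n * θ) : ℝ) : ℂ) := by
    intro n
    have hcont : Continuous fun x : ℝ => fourier (-n) (x : AddCircle (2 * π))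
        • F (x : AddCircle (2 * π)) := by
      have h1 : Continuous fun x : ℝ => (x : AddCircle (2 * π)) := AddCircle.continuous_mk' _
      exact ((fourier (-n)).continuous.comp h1).smul (F.continuous.comp h1)
    rw [fourierCoeff_eq_intervalIntegral _ n (-π), show -π + 2 * π = π by ring,
      ← integral_add_adjacent_intervals (hcont.intervalIntegrable (-π) 0)
        (hcont.intervalIntegrable 0 π)]
    have hneg := intervalIntegral.integral_comp_neg (a := 0) (b := π)
      (fun x : ℝ => fourier (-n) (x : AddCircle (2 * π)) • F (x : AddCircle (2 * π)))
    rw [neg_zero] at hneg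
    have hcont' : Continuous fun x : ℝ => fourier (-n) ((-x : ℝ) : AddCircle (2 * π))
        • F ((-x : ℝ) : AddCircle (2 * π)) := hcont.comp continuous_neg
    rw [← hneg, ← integral_add (hcont'.intervalIntegrable _ _)
      (hcont.intervalIntegrable _ _)]
    have hint : ∫ x in (0 : ℝ)..π, (fourier (-n) ((-x : ℝ) : AddCircle (2 * π))
          • F ((-x : ℝ) : AddCircle (2 * π))
          + fourier (-n) (x : AddCircle (2 * π)) • F (x : AddCircle (2 * π)))
        = ∫ x in (0 : ℝ)..π, ((2 * (R x * cos (n * x)) : ℝ) : ℂ) := by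
      refine integral_congr fun x hx => ?_
      rw [uIcc_of_le pi_pos.le] at hx
      simp only [hFx x hx, hFn x hx, hfour, smul_eq_mul]
      rw [Complex.exp_mul_I, Complex.exp_mul_I]
      push_cast
      simp only [neg_mul, mul_neg, neg_neg, Complex.cos_neg, Complex.sin_neg]
      ring
    rw [hint, intervalIntegral.integral_ofReal, intervalIntegral.integral_const_mul]
    have : (π : ℂ) ≠ 0 := by exact_mod_cast pi_ne_zero
    rw [Complex.real_smul]
    push_cast
    field_simp
  have hsum : Summable (fourierCoeff F) := by
    simp only [funext hcoeff]
    exact Complex.summable_ofReal.2 (hs.mul_left _)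
  have h := Complex.hasSum_re (has_pointwise_sum_fourier_series_of_summable hsum
    (θ : AddCircle (2 * π)))
  rw [hFx θ hθ, Complex.ofReal_re] at h
  refine (congrArg (fun f => HasSum f (R θ)) (funext fun n => ?_)).mp h
  rw [hcoeff, hfour, smul_eq_mul, Complex.re_ofReal_mul, Complex.exp_ofReal_mul_I_re]

theorem zonalPairing_finsetSum_cos (d : ℕ) (hd : 2 ≤ d) (k : ℕ) (c : ℤ → ℝ) (s : Finset ℤ)
    (hs : ∀ n ∈ s, n.natAbs < k) :
    zonalPairing d (fun θ => ∑ n ∈ s, c n * cos (n * θ)) k = 0 := by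
  induction s using Finset.induction_on with
  | empty => simp [zonalPairing]
  | insert a s ha ih =>
    simp only [Finset.sum_insert ha]
    have hc : Continuous fun θ : ℝ => c a * cos (a * θ) := by fun_prop
    have hS : Continuous fun θ : ℝ => ∑ n ∈ s, c n * cos (n * θ) := by fun_prop
    rw [zonalPairing_add hc.continuousOn hS.continuousOn,
      ih fun n hn => hs n (Finset.mem_insert_of_mem hn), zonalPairing_const_mul]
    have h : (fun θ : ℝ => cos (a * θ)) = fun θ : ℝ => cos ((a.natAbs : ℕ) * θ) := by
      funext θ
      rw [Nat.cast_natAbs]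
      rcases abs_choice a with h | h <;> rw [h]
      push_cast
      rw [neg_mul, cos_neg]
    rw [h, zonalPairing_cos_nat_mul d hd (hs a (Finset.mem_insert_self _ _))]
    simp

/-- The cosine sum over `|n| < k` is a polynomial in `cos θ` of degree below `k`, so `P_k` does not
see it; the tail is bounded in sup norm. Coefficients are `O(n^(-2M-2))`: the factor `n^(-2)` is
kept for summability and the rest gives `k^(-2M)`. -/
theorem exists_abs_zonalPairing_mul_pow_le (d : ℕ) (hd : 2 ≤ d) (M : ℕ) {R : ℝ → ℝ}
    (hR : AnalyticOnNhd ℝ R (Icc 0 π))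
    (h0 : ∀ i < M + 1, deriv^[2 * i + 1] R 0 = 0) (hπ : ∀ i < M + 1, deriv^[2 * i + 1] R π = 0) :
    ∃ C : ℝ, ∀ k : ℕ, 1 ≤ k → |zonalPairing d R k| * (k : ℝ) ^ (2 * M) ≤ C := by
  obtain ⟨C₁, hC₁, hE⟩ := exists_abs_zonalPairing_le d hd
  set a : ℤ → ℝ := fun n => ∫ θ in (0 : ℝ)..π, R θ * cos (n * θ) with ha
  obtain ⟨C₀, hC₀⟩ := isCompact_Icc.exists_bound_of_continuousOn
    (hR.iterated_deriv (2 * (M + 1))).continuousOn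
  have hC₀0 : 0 ≤ C₀ := (norm_nonneg _).trans (hC₀ 0 (left_mem_Icc.2 pi_pos.le))
  have hbound : ∀ n : ℤ, |a n| * |(n : ℝ)| ^ (2 * (M + 1)) ≤ C₀ * π := fun n => by
    have h := congrArg abs (pow_mul_integral_mul_cos (M + 1) hR h0 hπ n)
    rw [abs_mul, abs_mul, abs_pow, abs_pow, abs_neg, abs_one, one_pow, one_mul] at h
    rw [mul_comm, ha, h, ← norm_eq_abs]
    refine (intervalIntegral.norm_integral_le_of_norm_le_const (C := C₀) fun θ hθ => ?_).trans ?_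
    · rw [uIoc_of_le pi_pos.le] at hθ
      rw [norm_mul]
      refine (mul_le_mul (hC₀ θ (Ioc_subset_Icc_self hθ)) (abs_cos_le_one _) (abs_nonneg _)
        hC₀0).trans (mul_one _).le
    · rw [sub_zero, abs_of_pos pi_pos]
  have hsq : Summable fun n : ℤ => 1 / (n : ℝ) ^ 2 := Real.summable_one_div_int_pow.2 (by norm_num)
  have htail : ∀ (k : ℕ), 1 ≤ k → ∀ n : ℤ, k ≤ n.natAbs →
      |a n| ≤ C₀ * π / (k : ℝ) ^ (2 * M) * (1 / (n : ℝ) ^ 2) := fun k hk n hn => by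
    have hk' : (0 : ℝ) < k := by exact_mod_cast hk
    have hkn : (k : ℝ) ≤ |(n : ℝ)| := by
      rw [← Int.cast_abs, ← Nat.cast_natAbs]
      exact_mod_cast hn
    have hn0 : 0 < |(n : ℝ)| := hk'.trans_le hkn
    have h1 := hbound n
    rw [mul_add, pow_add, mul_one, sq_abs] at h1
    have hn2 : 0 < (n : ℝ) ^ 2 := by rw [← sq_abs]; positivity
    rw [mul_one_div, div_div, le_div_iff₀ (by positivity)]
    refine le_trans ?_ h1
    gcongr
  have hsum : Summable a := by
    refine Summable.of_norm_bounded_eventually (hsq.mul_left (C₀ * π / (1 : ℕ) ^ (2 * M))) ?_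
    filter_upwards [(finite_singleton (0 : ℤ)).compl_mem_cofinite] with n hn
    exact htail 1 le_rfl n (Int.natAbs_pos.2 hn)
  refine ⟨C₁ * (π⁻¹ * (C₀ * π) * ∑' n : ℤ, 1 / (n : ℝ) ^ 2), fun k hk => ?_⟩
  have hk' : (0 : ℝ) < k := by exact_mod_cast hk
  set s : Finset ℤ := Finset.Ioo (-(k : ℤ)) k with hs
  have hmem : ∀ n, n ∈ s ↔ n.natAbs < k := fun n => by
    rw [hs, Finset.mem_Ioo]
    omega
  set S : ℝ → ℝ := fun θ => ∑ n ∈ s, π⁻¹ * a n * cos (n * θ) with hS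
  have hScont : Continuous S := by fun_prop
  have hRS : ∀ θ ∈ Icc 0 π, |R θ - S θ|
      ≤ π⁻¹ * (C₀ * π / (k : ℝ) ^ (2 * M)) * ∑' n : ℤ, 1 / (n : ℝ) ^ 2 := fun θ hθ => by
    have h1 := hasSum_cosine_series hR.continuousOn hsum hθ
    have h2 : HasSum (fun n : ℤ => if n ∈ s then π⁻¹ * a n * cos (n * θ) else 0) (S θ) := by
      have := hasSum_sum_of_ne_finset_zero (s := s) (L := .unconditional ℤ)
        (f := fun n : ℤ => if n ∈ s then π⁻¹ * a n * cos (n * θ) else 0)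
        fun n hn => if_neg hn
      rwa [Finset.sum_congr rfl fun n hn => if_pos hn] at this
    rw [← norm_eq_abs]
    refine (h1.sub h2).norm_le_of_bounded
      (hsq.hasSum.mul_left (π⁻¹ * (C₀ * π / (k : ℝ) ^ (2 * M)))) fun n => ?_
    by_cases hn : n ∈ s
    · rw [if_pos hn, sub_self, norm_zero]
      positivity
    · rw [if_neg hn, sub_zero, norm_mul, norm_mul, norm_of_nonneg (inv_pos.2 pi_pos).le, mul_assoc,
        mul_assoc]
      refine mul_le_mul_of_nonneg_left ?_ (inv_pos.2 pi_pos).le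
      refine (mul_le_of_le_one_right (norm_nonneg _) (abs_cos_le_one _)).trans ?_
      exact htail k hk n (not_lt.1 fun h => hn ((hmem n).2 h))
  have h := hE (fun θ => R θ - S θ) _ k hk hRS
  rw [zonalPairing_sub hR.continuousOn hScont.continuousOn,
    zonalPairing_finsetSum_cos d hd k _ s fun n hn => (hmem n).1 hn, sub_zero] at h
  calc |zonalPairing d R k| * (k : ℝ) ^ (2 * M) ≤ _ * (k : ℝ) ^ (2 * M) :=
        mul_le_mul_of_nonneg_right h (by positivity)
    _ = _ := by field_simp

/-! ### Removing odd endpoint derivatives by half-angle powers. -/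

theorem iterate_deriv_sub {f g : ℝ → ℝ} {x : ℝ} (hf : AnalyticAt ℝ f x) (hg : AnalyticAt ℝ g x)
    (n : ℕ) : deriv^[n] (fun y => f y - g y) x = deriv^[n] f x - deriv^[n] g x := by
  simp only [← iteratedDeriv_eq_iterate]
  exact iteratedDeriv_fun_sub hf.contDiffAt hg.contDiffAt

theorem iterate_deriv_const_mul (c : ℝ) (f : ℝ → ℝ) (x : ℝ) (n : ℕ) :
    deriv^[n] (fun y => c * f y) x = c * deriv^[n] f x := by
  simp only [← iteratedDeriv_eq_iterate]
  exact iteratedDeriv_const_mul_field c f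

theorem iterate_deriv_two_sin_half_pow (j : ℕ) :
    deriv^[2] (fun θ : ℝ => sin (θ / 2) ^ j)
      = fun θ => (j * (j - 1) / 4 : ℝ) * sin (θ / 2) ^ (j - 2)
        - (j ^ 2 / 4 : ℝ) * sin (θ / 2) ^ j := by
  have h1 : deriv (fun θ : ℝ => sin (θ / 2) ^ j)
      = fun θ => j * sin (θ / 2) ^ (j - 1) * (cos (θ / 2) / 2) :=
    funext fun θ => (hasDerivAt_sin_half_pow j θ).deriv
  simp only [Function.iterate_succ, Function.iterate_zero, Function.comp_apply, id, h1]
  funext θ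
  have h2 : HasDerivAt (fun θ : ℝ => cos (θ / 2) / 2) (-sin (θ / 2) * (1 / 2) / 2) θ :=
    ((hasDerivAt_id θ).div_const 2).cos.div_const 2
  have h3 := (((hasDerivAt_sin_half_pow (j - 1) θ).const_mul (j : ℝ)).mul h2).deriv
  refine h3.trans ?_
  have hc := sin_sq_add_cos_sq (θ / 2)
  match j with
  | 0 => simp
  | 1 => simp; ring
  | j + 2 =>
    simp only [show j + 2 - 1 = j + 1 by omega, Nat.add_sub_cancel]
    push_cast
    linear_combination ((j + 2) * (j + 1) / 4 * sin (θ / 2) ^ j : ℝ) * hc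

theorem iterate_deriv_add_two_sin_half_pow (j n : ℕ) (x : ℝ) :
    deriv^[n + 2] (fun θ : ℝ => sin (θ / 2) ^ j) x
      = (j * (j - 1) / 4 : ℝ) * deriv^[n] (fun θ : ℝ => sin (θ / 2) ^ (j - 2)) x
        - (j ^ 2 / 4 : ℝ) * deriv^[n] (fun θ : ℝ => sin (θ / 2) ^ j) x := by
  rw [Function.iterate_add_apply, iterate_deriv_two_sin_half_pow,
    iterate_deriv_sub (by fun_prop) (by fun_prop),
    iterate_deriv_const_mul, iterate_deriv_const_mul]

theorem deriv_sin_half_pow (j : ℕ) (x : ℝ) :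
    deriv (fun θ : ℝ => sin (θ / 2) ^ j) x = j * sin (x / 2) ^ (j - 1) * (cos (x / 2) / 2) :=
  (hasDerivAt_sin_half_pow j x).deriv

/-- `sin (θ/2)` is symmetric about `π`, so subtracting its powers changes odd derivatives at `0`
without disturbing those at `π`. -/
theorem iterate_deriv_sin_half_pow_pi (m j : ℕ) :
    deriv^[2 * m + 1] (fun θ : ℝ => sin (θ / 2) ^ j) π = 0 := by
  induction m generalizing j with
  | zero => simp [deriv_sin_half_pow]
  | succ m ih =>
    rw [show 2 * (m + 1) + 1 = 2 * m + 1 + 2 by ring, iterate_deriv_add_two_sin_half_pow, ih, ih]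
    simp

theorem iterate_deriv_sin_half_pow_zero {m j : ℕ} (h : 2 * m + 1 < j) :
    deriv^[2 * m + 1] (fun θ : ℝ => sin (θ / 2) ^ j) 0 = 0 := by
  induction m generalizing j with
  | zero => simp [deriv_sin_half_pow, show j - 1 ≠ 0 by omega]
  | succ m ih =>
    rw [show 2 * (m + 1) + 1 = 2 * m + 1 + 2 by ring, iterate_deriv_add_two_sin_half_pow,
      ih (by omega), ih (by omega)]
    simp

theorem iterate_deriv_sin_half_pow_self (m : ℕ) :
    0 < deriv^[2 * m + 1] (fun θ : ℝ => sin (θ / 2) ^ (2 * m + 1)) 0 := by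
  induction m with
  | zero => simp
  | succ m ih =>
    rw [show 2 * (m + 1) + 1 = 2 * m + 1 + 2 by ring, iterate_deriv_add_two_sin_half_pow,
      iterate_deriv_sin_half_pow_zero (show 2 * m + 1 < 2 * m + 1 + 2 by omega),
      Nat.add_sub_cancel, mul_zero, sub_zero]
    push_cast
    have : (0 : ℝ) ≤ m := Nat.cast_nonneg m
    have : (0 : ℝ) < 2 * m + 1 + 2 - 1 := by linarith
    positivity

theorem iterate_deriv_sin_half_cube :
    deriv^[3] (fun θ : ℝ => sin (θ / 2) ^ 3) 0 = 3 / 4 := by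
  have h := iterate_deriv_add_two_sin_half_pow 3 1 0
  rw [Function.iterate_one, deriv_sin_half_pow, deriv_sin_half_pow] at h
  norm_num at h ⊢
  exact h

theorem iterate_deriv_cos_half_pow (n j : ℕ) (x : ℝ) :
    deriv^[n] (fun θ : ℝ => cos (θ / 2) ^ j) x
      = (-1) ^ n * deriv^[n] (fun θ : ℝ => sin (θ / 2) ^ j) (π - x) := by
  have h : (fun θ : ℝ => cos (θ / 2) ^ j) = fun θ => (fun θ : ℝ => sin (θ / 2) ^ j) (π - θ) := by
    funext θ
    simp only
    rw [← sin_pi_div_two_sub]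
    ring_nf
  rw [h, ← iteratedDeriv_eq_iterate, ← iteratedDeriv_eq_iterate]
  have h2 := congrFun (iteratedDeriv_comp_const_sub n (fun θ : ℝ => sin (θ / 2) ^ j) π) x
  simpa using h2

theorem zonalPairing_cos_half_pow (d j k : ℕ) :
    zonalPairing d (fun θ => cos (θ / 2) ^ j) k
      = (-1) ^ k * zonalPairing d (fun θ => sin (θ / 2) ^ j) k := by
  rw [← zonalPairing_reflect]
  refine zonalPairing_congr (fun θ _ => ?_) k
  rw [← sin_pi_div_two_sub]
  ring_nf

/-- Subtracting one layer of half-angle powers kills one more pair of odd derivatives. -/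
theorem exists_sub_half_pow (M : ℕ) {R : ℝ → ℝ} (hR : AnalyticOnNhd ℝ R (Icc 0 π))
    (h0 : ∀ i < M, deriv^[2 * i + 1] R 0 = 0) (hπ : ∀ i < M, deriv^[2 * i + 1] R π = 0) :
    ∃ S : ℝ → ℝ, AnalyticOnNhd ℝ S (Icc 0 π) ∧
      (∀ i < M + 1, deriv^[2 * i + 1] S 0 = 0) ∧ (∀ i < M + 1, deriv^[2 * i + 1] S π = 0) ∧
      ∀ d k, zonalPairing d R k = (deriv^[2 * M + 1] R 0 - (-1) ^ k * deriv^[2 * M + 1] R π)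
          / deriv^[2 * M + 1] (fun θ : ℝ => sin (θ / 2) ^ (2 * M + 1)) 0
          * zonalPairing d (fun θ => sin (θ / 2) ^ (2 * M + 1)) k + zonalPairing d S k := by
  have hs := iterate_deriv_sin_half_pow_self M
  set s := deriv^[2 * M + 1] (fun θ : ℝ => sin (θ / 2) ^ (2 * M + 1)) 0 with hsdef
  -- The sine power corrects the endpoint `0` and the cosine power the endpoint `π`. The minus sign
  -- in `b` comes from reflection, which reverses odd derivatives.
  set a := deriv^[2 * M + 1] R 0 / s with ha
  set b := -deriv^[2 * M + 1] R π / s with hb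
  have hf : ∀ x, AnalyticAt ℝ (fun θ => a * sin (θ / 2) ^ (2 * M + 1)) x := by fun_prop
  have hg : ∀ x, AnalyticAt ℝ (fun θ => b * cos (θ / 2) ^ (2 * M + 1)) x := by fun_prop
  have hderiv : ∀ x ∈ Icc 0 π, ∀ n, deriv^[n] (fun θ => R θ - a * sin (θ / 2) ^ (2 * M + 1)
      - b * cos (θ / 2) ^ (2 * M + 1)) x = deriv^[n] R x
        - a * deriv^[n] (fun θ : ℝ => sin (θ / 2) ^ (2 * M + 1)) x
        - b * ((-1) ^ n * deriv^[n] (fun θ : ℝ => sin (θ / 2) ^ (2 * M + 1)) (π - x)) := by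
    intro x hx n
    rw [iterate_deriv_sub ((hR x hx).fun_sub (hf x)) (hg x), iterate_deriv_sub (hR x hx) (hf x),
      iterate_deriv_const_mul, iterate_deriv_const_mul, iterate_deriv_cos_half_pow]
  have hodd : ∀ i : ℕ, (-1 : ℝ) ^ (2 * i + 1) = -1 := fun i => by
    rw [pow_succ, pow_mul]
    simp
  refine ⟨fun θ => R θ - a * sin (θ / 2) ^ (2 * M + 1) - b * cos (θ / 2) ^ (2 * M + 1),
    fun x hx => ((hR x hx).fun_sub (hf x)).fun_sub (hg x), ?_, ?_, ?_⟩
  · intro i hi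
    rw [hderiv 0 (left_mem_Icc.2 pi_pos.le), sub_zero, iterate_deriv_sin_half_pow_pi]
    rcases Nat.lt_succ_iff_lt_or_eq.1 hi with hi | rfl
    · rw [h0 i hi, iterate_deriv_sin_half_pow_zero (by omega)]
      simp
    · rw [← hsdef, ha]
      field_simp
      simp
  · intro i hi
    rw [hderiv π (right_mem_Icc.2 pi_pos.le), sub_self, iterate_deriv_sin_half_pow_pi, hodd]
    rcases Nat.lt_succ_iff_lt_or_eq.1 hi with hi | rfl
    · rw [hπ i hi, iterate_deriv_sin_half_pow_zero (by omega)]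
      simp
    · rw [← hsdef, hb]
      field_simp
      simp
  · intro d k
    have cf : ContinuousOn (fun θ => a * sin (θ / 2) ^ (2 * M + 1)) (Icc 0 π) :=
      fun x _ => (hf x).continuousAt.continuousWithinAt
    have cg : ContinuousOn (fun θ => b * cos (θ / 2) ^ (2 * M + 1)) (Icc 0 π) :=
      fun x _ => (hg x).continuousAt.continuousWithinAt
    have cRf : ContinuousOn (fun θ => R θ - a * sin (θ / 2) ^ (2 * M + 1)) (Icc 0 π) :=
      hR.continuousOn.sub cf
    rw [zonalPairing_sub cRf cg, zonalPairing_sub hR.continuousOn cf,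
      zonalPairing_const_mul, zonalPairing_const_mul, zonalPairing_cos_half_pow, ha, hb]
    ring

theorem tendsto_zonalPairing_sin_half_pow_zero (d : ℕ) (hd : 2 ≤ d) (m : ℕ) :
    Tendsto (fun k : ℕ => zonalPairing d (fun θ => sin (θ / 2) ^ (2 * (m + 2) + 1)) k
      * (k : ℝ) ^ (d + 2)) atTop (nhds 0) := by
  have h := tendsto_zonalPairing_sin_half_pow d hd (2 * (m + 2) + 1) ⟨m + 2, rfl⟩
  have h2 : Tendsto (fun k : ℕ => ((k : ℝ) ^ (2 * m + 2))⁻¹) atTop (nhds 0) :=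
    ((tendsto_pow_atTop (by omega)).comp tendsto_natCast_atTop_atTop).inv_tendsto_atTop
  have h3 := h.mul h2
  rw [mul_zero] at h3
  refine h3.congr' ?_
  filter_upwards [eventually_gt_atTop 0] with k hk
  have hk' : (0 : ℝ) < k := by exact_mod_cast hk
  rw [show 2 * (m + 2) + 1 + d - 1 = (d + 2) + (2 * m + 2) by omega, pow_add _ (d + 2)]
  field_simp

/-- Only the cube contributes at order `k^(-d-2)`, with `4/3` the inverse of its third derivative at
`0`. Later layers have power at least `5` and coefficients bounded in `k`, so they go into `e`. -/
theorem exists_zonalPairing_expansion (d : ℕ) (hd : 2 ≤ d) (M : ℕ) {h : ℝ → ℝ}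
    (hh : AnalyticOnNhd ℝ h (Icc 0 π)) (h0 : deriv h 0 = 0) (hπ : deriv h π = 0) :
    ∃ (S : ℝ → ℝ) (e : ℕ → ℝ), AnalyticOnNhd ℝ S (Icc 0 π) ∧
      (∀ i < M + 2, deriv^[2 * i + 1] S 0 = 0) ∧ (∀ i < M + 2, deriv^[2 * i + 1] S π = 0) ∧
      Tendsto (fun k : ℕ => e k * (k : ℝ) ^ (d + 2)) atTop (nhds 0) ∧
      ∀ k, zonalPairing d h k = 4 / 3 * (deriv^[3] h 0 - (-1) ^ k * deriv^[3] h π)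
          * zonalPairing d (fun θ => sin (θ / 2) ^ 3) k + e k + zonalPairing d S k := by
  induction M with
  | zero =>
    obtain ⟨S, hS, hS0, hSπ, hSk⟩ := exists_sub_half_pow 1 hh
      (fun i hi => by obtain rfl : i = 0 := by omega
                      exact h0)
      (fun i hi => by obtain rfl : i = 0 := by omega
                      exact hπ)
    refine ⟨S, fun _ => 0, hS, hS0, hSπ, by simp, fun k => ?_⟩
    rw [hSk d k]
    norm_num only [iterate_deriv_sin_half_cube]
    ring
  | succ M ih =>
    obtain ⟨R, e, hR, hR0, hRπ, he, hk⟩ := ih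
    obtain ⟨S, hS, hS0, hSπ, hSk⟩ := exists_sub_half_pow (M + 2) hR hR0 hRπ
    refine ⟨S, fun k => e k + (zonalPairing d R k - zonalPairing d S k), hS, hS0, hSπ, ?_,
      fun k => ?_⟩
    · simp only [add_mul]
      rw [← add_zero (0 : ℝ)]
      refine he.add ?_
      set A := deriv^[2 * (M + 2) + 1] R 0
      set B := deriv^[2 * (M + 2) + 1] R π
      set s := deriv^[2 * (M + 2) + 1] (fun θ : ℝ => sin (θ / 2) ^ (2 * (M + 2) + 1)) 0
      have hb : ∀ k : ℕ, |(A - (-1) ^ k * B) / s| ≤ (|A| + |B|) / |s| := fun k => by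
        rw [abs_div]
        gcongr
        refine (abs_sub _ _).trans ?_
        rw [abs_mul, abs_pow, abs_neg, abs_one, one_pow, one_mul]
      have ht := (tendsto_zonalPairing_sin_half_pow_zero d hd M).abs.const_mul ((|A| + |B|) / |s|)
      rw [abs_zero, mul_zero] at ht
      refine squeeze_zero_norm (fun k => ?_) ht
      rw [hSk d k, add_sub_cancel_right, mul_assoc, norm_mul]
      exact mul_le_mul_of_nonneg_right (hb k) (abs_nonneg _)
    · rw [hk k]
      ring

theorem exists_tendsto_zonalPairing (d : ℕ) (hd : 2 ≤ d) :
    ∃ K : ℝ, 0 < K ∧ ∀ h : ℝ → ℝ, AnalyticOnNhd ℝ h (Icc 0 π) → deriv h 0 = 0 → deriv h π = 0 →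
      Tendsto (fun k : ℕ => zonalPairing d h k * (k : ℝ) ^ (d + 2)
        - K * (deriv^[3] h 0 - (-1) ^ k * deriv^[3] h π)) atTop (nhds 0) := by
  obtain ⟨c, hc, hct⟩ := exists_pos_tendsto_zonalPairing_sin_half_cube d hd
  refine ⟨4 / 3 * c, by positivity, fun h hh h0 hπ => ?_⟩
  -- With this many layers removed, the remainder decays like `k^(-2(d+2))`, which beats `k^(-d-2)`.
  obtain ⟨S, e, hS, hS0, hSπ, he, hk⟩ := exists_zonalPairing_expansion d hd (d + 1) hh h0 hπ
  obtain ⟨C, hC⟩ := exists_abs_zonalPairing_mul_pow_le d hd (d + 2) hS hS0 hSπ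
  set A := deriv^[3] h 0
  set B := deriv^[3] h π
  have hSt : Tendsto (fun k : ℕ => zonalPairing d S k * (k : ℝ) ^ (d + 2)) atTop (nhds 0) := by
    have h2 : Tendsto (fun k : ℕ => C * ((k : ℝ) ^ (d + 2))⁻¹) atTop (nhds 0) := by
      simpa using (((tendsto_pow_atTop (by omega : d + 2 ≠ 0)).comp
        tendsto_natCast_atTop_atTop).inv_tendsto_atTop).const_mul C
    refine squeeze_zero_norm' ?_ h2
    filter_upwards [eventually_ge_atTop 1] with k hk
    have hk' : (0 : ℝ) < k := by exact_mod_cast hk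
    have := hC k hk
    rw [two_mul, pow_add, ← mul_assoc] at this
    rw [norm_mul, norm_of_nonneg (by positivity : (0 : ℝ) ≤ (k : ℝ) ^ (d + 2)), ← div_eq_mul_inv,
      le_div_iff₀ (by positivity)]
    exact this
  have hm : Tendsto (fun k : ℕ => 4 / 3 * (A - (-1) ^ k * B)
      * (zonalPairing d (fun θ => sin (θ / 2) ^ 3) k * (k : ℝ) ^ (d + 2) - c)) atTop (nhds 0) := by
    have ht := (hct.sub_const c).abs.const_mul (4 / 3 * (|A| + |B|))
    rw [sub_self, abs_zero, mul_zero] at ht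
    refine squeeze_zero_norm (fun k => ?_) ht
    rw [norm_mul, norm_mul, norm_of_nonneg (by norm_num : (0 : ℝ) ≤ 4 / 3)]
    refine mul_le_mul_of_nonneg_right (mul_le_mul_of_nonneg_left ?_ (by norm_num)) (abs_nonneg _)
    refine (abs_sub _ _).trans ?_
    rw [abs_mul, abs_pow, abs_neg, abs_one, one_pow, one_mul]
  have := (hm.add he).add hSt
  simp only [add_zero] at this
  refine this.congr fun k => ?_
  rw [hk k]
  ring

/-! ### Third-order chain rule. -/

section ChainRule

variable {f g : ℝ → ℝ} {x : ℝ}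

theorem deriv_comp_of_analyticAt (hf : AnalyticAt ℝ f (g x)) (hg : AnalyticAt ℝ g x) :
    deriv (f ∘ g) x = deriv f (g x) * deriv g x :=
  deriv_comp x hf.differentiableAt hg.differentiableAt

theorem iterate_deriv_two_comp (hf : AnalyticAt ℝ f (g x)) (hg : AnalyticAt ℝ g x) :
    deriv^[2] (f ∘ g) x
      = deriv^[2] f (g x) * deriv g x ^ 2 + deriv f (g x) * deriv^[2] g x := by
  have hev : deriv (f ∘ g) =ᶠ[nhds x] fun y => (deriv f ∘ g) y * deriv g y := by
    filter_upwards [hg.continuousAt.eventually hf.eventually_analyticAt, hg.eventually_analyticAt]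
      with y h1 h2 using deriv_comp_of_analyticAt h1 h2
  have h1 : AnalyticAt ℝ (deriv f ∘ g) x := hf.deriv.comp hg
  simp only [Function.iterate_succ, Function.iterate_zero, Function.comp_apply, id]
  rw [hev.deriv_eq, deriv_fun_mul h1.differentiableAt hg.deriv.differentiableAt,
    deriv_comp_of_analyticAt hf.deriv hg, Function.comp_apply]
  ring

theorem iterate_deriv_three_comp (hf : AnalyticAt ℝ f (g x)) (hg : AnalyticAt ℝ g x) :
    deriv^[3] (f ∘ g) x
      = deriv^[3] f (g x) * deriv g x ^ 3 + 3 * deriv^[2] f (g x) * deriv g x * deriv^[2] g x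
        + deriv f (g x) * deriv^[3] g x := by
  have hev : deriv (f ∘ g) =ᶠ[nhds x] fun y => (deriv f ∘ g) y * deriv g y := by
    filter_upwards [hg.continuousAt.eventually hf.eventually_analyticAt, hg.eventually_analyticAt]
      with y h1 h2 using deriv_comp_of_analyticAt h1 h2
  have hev2 : deriv^[2] (f ∘ g) =ᶠ[nhds x] fun y =>
      (deriv^[2] f ∘ g) y * deriv g y ^ 2 + (deriv f ∘ g) y * deriv^[2] g y := by
    filter_upwards [hg.continuousAt.eventually hf.eventually_analyticAt, hg.eventually_analyticAt]
      with y h1 h2 using iterate_deriv_two_comp h1 h2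
  have h1 : AnalyticAt ℝ (deriv f ∘ g) x := hf.deriv.comp hg
  have h2 : AnalyticAt ℝ (deriv^[2] f ∘ g) x := (hf.iterated_deriv 2).comp hg
  have h3 := h2.differentiableAt.hasDerivAt.mul (hg.deriv.differentiableAt.hasDerivAt.pow 2)
  have h4 := h1.differentiableAt.hasDerivAt.mul
    (hg.iterated_deriv 2).differentiableAt.hasDerivAt
  rw [Function.iterate_succ_apply' deriv 2, hev2.deriv_eq]
  refine (h3.add h4).deriv.trans ?_
  rw [deriv_comp_of_analyticAt (hf.iterated_deriv 2) hg, deriv_comp_of_analyticAt hf.deriv hg]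
  simp only [Function.iterate_succ, Function.iterate_zero, Function.comp_apply, id, Pi.pow_apply]
  ring

end ChainRule

/-! ### The kernel in the angle variable and its angle map. -/

/-- The function `θ ↦ κ₁(cos θ)`, continued from `[0, π]` to the whole line. -/
def kappaCos (θ : ℝ) : ℝ := ((π - θ) * cos θ + sin θ) / π

theorem kappaOne_cos {θ : ℝ} (hθ : θ ∈ Icc 0 π) : kappaOne (cos θ) = kappaCos θ := by
  rw [kappaOne, kappaCos, arccos_cos hθ.1 hθ.2, ← sin_sq, sqrt_sq (sin_nonneg_of_mem_Icc hθ)]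
  ring

theorem analyticAt_kappaCos (x : ℝ) : AnalyticAt ℝ kappaCos x := by
  unfold kappaCos
  fun_prop (disch := exact pi_ne_zero)

theorem deriv_kappaCos : deriv kappaCos = fun θ => -((π - θ) * sin θ) / π := by
  funext θ
  have h := ((((hasDerivAt_id θ).const_sub π).mul (hasDerivAt_cos θ)).add
    (hasDerivAt_sin θ)).div_const π
  refine h.deriv.trans ?_
  simp only [id]
  ring

theorem iterate_deriv_two_kappaCos :
    deriv^[2] kappaCos = fun θ => (sin θ - (π - θ) * cos θ) / π := by
  simp only [Function.iterate_succ, Function.iterate_zero, Function.comp_apply, id, deriv_kappaCos]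
  funext θ
  have h := (((hasDerivAt_id θ).const_sub π).mul (hasDerivAt_sin θ)).neg.div_const π
  refine h.deriv.trans ?_
  simp only [id]
  ring

theorem iterate_deriv_three_kappaCos :
    deriv^[3] kappaCos = fun θ => (2 * cos θ + (π - θ) * sin θ) / π := by
  rw [Function.iterate_succ_apply' deriv 2, iterate_deriv_two_kappaCos]
  funext θ
  have h := ((hasDerivAt_sin θ).sub
    (((hasDerivAt_id θ).const_sub π).mul (hasDerivAt_cos θ))).div_const π
  refine h.deriv.trans ?_
  simp only [id]
  ring

theorem kappaCos_zero : kappaCos 0 = 1 := by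
  simp [kappaCos, pi_ne_zero]

theorem kappaCos_pi : kappaCos π = 0 := by
  simp [kappaCos]

theorem strictAntiOn_kappaCos : StrictAntiOn kappaCos (Icc 0 π) := by
  refine strictAntiOn_of_deriv_neg (convex_Icc _ _)
    (fun x _ => (analyticAt_kappaCos x).continuousAt.continuousWithinAt) fun x hx => ?_
  rw [interior_Icc] at hx
  rw [deriv_kappaCos]
  have h1 := sin_pos_of_mem_Ioo hx
  have h2 : 0 < π - x := sub_pos.2 hx.2
  exact div_neg_of_neg_of_pos (neg_neg_of_pos (mul_pos h2 h1)) pi_pos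

theorem kappaCos_nonneg {θ : ℝ} (hθ : θ ∈ Icc 0 π) : 0 ≤ kappaCos θ := by
  rw [← kappaCos_pi]
  exact strictAntiOn_kappaCos.antitoneOn hθ (right_mem_Icc.2 pi_pos.le) hθ.2

theorem kappaCos_lt_one {θ : ℝ} (hθ : θ ∈ Ioc 0 π) : kappaCos θ < 1 := by
  rw [← kappaCos_zero]
  exact strictAntiOn_kappaCos (left_mem_Icc.2 pi_pos.le) (Ioc_subset_Icc_self hθ) hθ.1

/-- `(1 - κ₁(cos θ)) / 2` is `θ²` times an analytic function, positive on `[0, π]`. -/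
theorem exists_one_sub_kappaCos_eq :
    ∃ q : ℝ → ℝ, AnalyticOnNhd ℝ q (Icc 0 π) ∧ (∀ θ, (1 - kappaCos θ) / 2 = θ ^ 2 * q θ) ∧
      q 0 = 1 / 4 ∧ ∀ θ ∈ Icc 0 π, 0 < q θ := by
  set F : ℝ → ℝ := fun θ => (1 - kappaCos θ) / 2 with hF
  have hFa : ∀ x, AnalyticAt ℝ F x := fun x => by
    have := analyticAt_kappaCos x
    fun_prop (disch := norm_num)
  have hF' : deriv F = fun θ => (π - θ) * sin θ / (2 * π) := by
    funext θ
    have h := ((analyticAt_kappaCos θ).differentiableAt.hasDerivAt.const_sub 1).div_const 2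
    refine h.deriv.trans ?_
    rw [deriv_kappaCos]
    field_simp
  have hF'' : deriv (deriv F) 0 = 1 / 2 := by
    rw [hF']
    have h := (((hasDerivAt_id (0 : ℝ)).const_sub π).mul (hasDerivAt_sin 0)).div_const (2 * π)
    refine h.deriv.trans ?_
    have := pi_ne_zero
    simp
    field_simp
  have hF0 : F 0 = 0 := by simp [hF, kappaCos_zero]
  have hF1 : deriv F 0 = 0 := by simp [hF']
  -- Here `F` and `F'` vanish at `0` and `F''(0) = 1/2`, so the Taylor expansion starts with `θ²/4`.
  -- Away from `0`, analyticity of the quotient is plain division.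
  obtain ⟨g, hg, hFg⟩ := (hFa 0).exists_eq_sum_add_pow_mul 3
  have hq : ∀ θ, F θ = θ ^ 2 * (1 / 4 + θ * g θ) := fun θ => by
    rw [hFg θ]
    simp [Finset.sum_range_succ, iteratedDeriv_succ, hF0, hF1, hF'']
    ring
  have hqdiv : ∀ θ, θ ≠ 0 → 1 / 4 + θ * g θ = F θ / θ ^ 2 := fun θ hθ => by
    rw [hq θ]
    field_simp
  refine ⟨fun θ => 1 / 4 + θ * g θ, fun x _ => ?_, hq, by simp, fun θ hθ => ?_⟩
  · rcases eq_or_ne x 0 with rfl | hx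
    · fun_prop
    · have h : AnalyticAt ℝ (fun θ => F θ / θ ^ 2) x :=
        (hFa x).div (by fun_prop) (pow_ne_zero 2 hx)
      refine h.congr ?_
      filter_upwards [isOpen_ne.mem_nhds hx] with y hy using (hqdiv y hy).symm
  · rcases eq_or_ne θ 0 with rfl | h0
    · norm_num
    · simp only [hqdiv θ h0]
      have h1 := kappaCos_lt_one ⟨lt_of_le_of_ne hθ.1 h0.symm, hθ.2⟩
      have h2 : 0 < F θ := by
        simp only [hF]
        linarith
      positivity

/-- The angle map of `κ₁`: an analytic `B` with `cos (B θ) = κ₁ (cos θ)`. -/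
theorem exists_angle_map :
    ∃ B : ℝ → ℝ, AnalyticOnNhd ℝ B (Icc 0 π) ∧ MapsTo B (Icc 0 π) (Icc 0 π) ∧
      (∀ x ∈ Icc 0 π, cos ∘ B =ᶠ[nhds x] kappaCos) ∧ B 0 = 0 ∧ deriv B 0 = 1 := by
  obtain ⟨q, hq, hqF, hq0, hqpos⟩ := exists_one_sub_kappaCos_eq
  -- `y` is the sine of half the new angle: `sin²(B/2) = (1 - κ₁(cos θ))/2`. Pulling `θ` out of the
  -- root makes it analytic at `0`, where `arccos` of the kernel would meet its branch point;
  -- `κ₁(cos θ) ≥ 0` keeps `y` below `1`, so `arcsin` is analytic too.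
  set y : ℝ → ℝ := fun θ => θ * √(q θ) with hy
  have hya : ∀ x ∈ Icc 0 π, AnalyticAt ℝ y x := fun x hx => by
    have h : AnalyticAt ℝ (fun θ => √(q θ)) x :=
      (contDiffAt_sqrt (hqpos x hx).ne').analyticAt.comp (hq x hx)
    exact analyticAt_id.fun_mul h
  have hysq : ∀ x, 0 ≤ q x → y x ^ 2 = (1 - kappaCos x) / 2 := fun x hx => by
    rw [hqF, hy, mul_pow, sq_sqrt hx]
  have hy0 : ∀ x ∈ Icc 0 π, 0 ≤ y x := fun x hx => mul_nonneg hx.1 (sqrt_nonneg _)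
  have hy1 : ∀ x ∈ Icc 0 π, y x < 1 := fun x hx => by
    have h1 := hysq x (hqpos x hx).le
    have h2 := kappaCos_nonneg hx
    nlinarith [hy0 x hx]
  have hasin : ∀ x ∈ Icc 0 π, AnalyticAt ℝ arcsin (y x) := fun x hx =>
    (contDiffAt_arcsin (by linarith [hy0 x hx] : -1 < y x).ne' (hy1 x hx).ne).analyticAt
  refine ⟨fun θ => 2 * arcsin (y θ), fun x hx => ?_, fun x hx => ?_, fun x hx => ?_, ?_, ?_⟩
  · exact analyticAt_const.fun_mul ((hasin x hx).comp (hya x hx))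
  · have := arcsin_nonneg.2 (hy0 x hx)
    have := arcsin_le_pi_div_two (y x)
    exact ⟨by linarith, by linarith⟩
  · have e1 : ∀ᶠ z in nhds x, y z < 1 :=
      (hya x hx).continuousAt.eventually_lt continuousAt_const (hy1 x hx)
    have e2 : ∀ᶠ z in nhds x, -1 < y z :=
      continuousAt_const.eventually_lt (hya x hx).continuousAt (by linarith [hy0 x hx])
    have e3 : ∀ᶠ z in nhds x, 0 < q z :=
      continuousAt_const.eventually_lt (hq x hx).continuousAt (hqpos x hx)
    filter_upwards [e1, e2, e3] with z h1 h2 h3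
    rw [Function.comp_apply, cos_two_mul, cos_sq', sin_arcsin h2.le h1.le, hysq z h3.le]
    ring
  · simp [hy]
  · have h0 : (0 : ℝ) ∈ Icc 0 π := left_mem_Icc.2 pi_pos.le
    have hs : AnalyticAt ℝ (fun θ => √(q θ)) 0 :=
      (contDiffAt_sqrt (hqpos 0 h0).ne').analyticAt.comp (hq 0 h0)
    have h1 := (hasDerivAt_id (0 : ℝ)).mul hs.differentiableAt.hasDerivAt
    have hyz : y 0 = 0 := by simp [hy]
    have h2 : HasDerivAt arcsin (1 / √(1 - y 0 ^ 2)) (y 0) :=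
      hasDerivAt_arcsin (by rw [hyz]; norm_num) (by rw [hyz]; norm_num)
    have h3 := ((h2.comp 0 h1).const_mul 2).deriv
    refine h3.trans ?_
    have : √(1 / 4 : ℝ) = 1 / 2 := by
      rw [show (1 / 4 : ℝ) = (1 / 2) ^ 2 by norm_num]
      exact sqrt_sq (by norm_num)
    simp only [hyz, hq0, this, id]
    norm_num

/-! ### Derivatives of the iterates of `κ₁` at `0`. -/

theorem hasDerivAt_kappaOne {u : ℝ} (h₁ : -1 < u) (h₂ : u < 1) :
    HasDerivAt kappaOne (1 - arccos u / π) u := by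
  have hpos : 0 < 1 - u ^ 2 := by nlinarith
  have hs := sqrt_pos.2 hpos
  have e1 := (hasDerivAt_id u).mul ((hasDerivAt_arccos h₁.ne' h₂.ne).const_sub π)
  have e2 : HasDerivAt (fun u : ℝ => √(1 - u ^ 2)) (-(2 * u) / (2 * √(1 - u ^ 2))) u := by
    have : HasDerivAt (fun u : ℝ => 1 - u ^ 2) (-(2 * u)) u := by
      simpa using (hasDerivAt_pow 2 u).const_sub 1
    exact this.sqrt hpos.ne'
  refine ((e1.add e2).div_const π).congr_deriv ?_
  have := pi_ne_zero
  simp only [id]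
  field_simp
  ring

theorem kappaOne_mem_Ico {u : ℝ} (hu : u ∈ Ico (0 : ℝ) 1) : kappaOne u ∈ Ico (0 : ℝ) 1 := by
  have h : arccos u ∈ Ioc 0 π := ⟨arccos_pos.2 hu.2, arccos_le_pi u⟩
  rw [← cos_arccos (by linarith [hu.1] : -1 ≤ u) hu.2.le, kappaOne_cos (Ioc_subset_Icc_self h)]
  exact ⟨kappaCos_nonneg (Ioc_subset_Icc_self h), kappaCos_lt_one h⟩

theorem deriv_kappaOne_mem {u : ℝ} (hu : u ∈ Ico (0 : ℝ) 1) :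
    1 - arccos u / π ∈ Ioo (0 : ℝ) 1 := by
  have h1 : arccos u ≤ π / 2 := arccos_le_pi_div_two.2 hu.1
  have h2 : 0 < arccos u := arccos_pos.2 hu.2
  have h3 := pi_pos
  constructor
  · rw [sub_pos, div_lt_one h3]
    linarith
  · have := div_pos h2 h3
    linarith

/-- The orbit of `u` stays in `[0, 1)`, where `κ₁' = 1 - arccos u / π` lies strictly between `0` and
`1`. -/
theorem hasDerivAt_iterate_kappaOne (m : ℕ) {u : ℝ} (hu : u ∈ Ico (0 : ℝ) 1) :
    ∃ D : ℝ, HasDerivAt (kappaOne^[m]) D u ∧ 0 < D ∧ D ≤ 1 := by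
  induction m generalizing u with
  | zero => exact ⟨1, hasDerivAt_id u, one_pos, le_rfl⟩
  | succ m ih =>
    obtain ⟨D, hD, h0, h1⟩ := ih (kappaOne_mem_Ico hu)
    have hκ := deriv_kappaOne_mem hu
    refine ⟨D * (1 - arccos u / π), ?_, mul_pos h0 hκ.1, mul_le_one₀ h1 hκ.1.le hκ.2.le⟩
    exact hD.comp u (hasDerivAt_kappaOne (by linarith [hu.1]) hu.2)

theorem deriv_iterate_kappaOne_zero_pos (m : ℕ) : 0 < deriv (kappaOne^[m]) 0 := by
  obtain ⟨D, hD, h0, -⟩ := hasDerivAt_iterate_kappaOne m (u := 0) (by simp)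
  rwa [hD.deriv]

/-- The innermost factor of the chain rule is `κ₁'(0) = 1/2` and the others are at most `1`. -/
theorem deriv_iterate_kappaOne_zero_le (m : ℕ) : deriv (kappaOne^[m + 1]) 0 ≤ 1 / 2 := by
  have h0 : (0 : ℝ) ∈ Ico (0 : ℝ) 1 := by simp
  obtain ⟨D, hD, -, h1⟩ := hasDerivAt_iterate_kappaOne m (kappaOne_mem_Ico h0)
  have hk := hasDerivAt_kappaOne (u := 0) (by norm_num) (by norm_num)
  have h : HasDerivAt (kappaOne^[m + 1]) (D * (1 - arccos 0 / π)) 0 := hD.comp 0 hk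
  have he : 1 - arccos 0 / π = 1 / 2 := by
    rw [arccos_zero]
    have := pi_ne_zero
    field_simp
    norm_num
  rw [h.deriv, he]
  linarith

/-! ### Endpoint jets of the deep kernels. -/

/-- The kernels `κ₁^[m + 1] ∘ cos` are analytic on `[0, π]`, with explicit third-order jets at the
endpoints. -/
theorem exists_analytic_iterate_kappaOne_cos (m : ℕ) :
    ∃ h : ℝ → ℝ, AnalyticOnNhd ℝ h (Icc 0 π) ∧ (∀ θ ∈ Icc 0 π, kappaOne^[m + 1] (cos θ) = h θ) ∧
      deriv h 0 = 0 ∧ deriv h π = 0 ∧ deriv^[3] h 0 = 2 / π * (m + 1) ∧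
      deriv^[3] h π = -(2 / π * deriv (kappaOne^[m]) 0) := by
  obtain ⟨B, hB, hBm, hcB, hB0, hB1⟩ := exists_angle_map
  have z0 : (0 : ℝ) ∈ Icc 0 π := left_mem_Icc.2 pi_pos.le
  have zπ : π ∈ Icc 0 π := right_mem_Icc.2 pi_pos.le
  have hpi := pi_ne_zero
  have c2 : deriv^[2] cos = fun x => -cos x := by
    simp [Function.iterate_succ]
  have c3 : deriv^[3] cos = sin := by
    rw [Function.iterate_succ_apply' deriv 2, c2]
    funext x
    simp
  have hca : ∀ x, AnalyticAt ℝ cos x := fun x => by fun_prop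
  have hiter : ∀ m, AnalyticOnNhd ℝ (cos ∘ B^[m]) (Icc 0 π) := fun m => by
    induction m with
    | zero => exact fun x _ => hca x
    | succ m ih => exact fun x hx => (ih (B x) (hBm hx)).comp (hB x hx)
  have hk : ∀ m, ∀ θ ∈ Icc 0 π, kappaOne^[m] (cos θ) = (cos ∘ B^[m]) θ := fun m => by
    induction m with
    | zero => exact fun θ _ => rfl
    | succ m ih =>
      intro θ hθ
      have h : kappaOne (cos θ) = cos (B θ) := by
        rw [kappaOne_cos hθ]
        exact (hcB θ hθ).self_of_nhds.symm
      rw [Function.iterate_succ_apply, h, ih _ (hBm hθ)]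
      rfl
  have hsucc : ∀ m, cos ∘ B^[m + 1] = (cos ∘ B^[m]) ∘ B := fun _ => rfl
  have hn : ∀ x ∈ Icc 0 π, ∀ n, deriv^[n] (cos ∘ B) x = deriv^[n] kappaCos x := fun x hx n => by
    rw [← iteratedDeriv_eq_iterate, ← iteratedDeriv_eq_iterate]
    exact (hcB x hx).iteratedDeriv_eq n
  -- Since `cos'` and `cos'''` vanish at `0`, the third-order chain rule reduces to `-3 B''(0) =
  -- 2/π`.
  have hB2 : deriv^[2] B 0 = -(2 / (3 * π)) := by
    have h := hn 0 z0 3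
    rw [iterate_deriv_three_comp (hca _) (hB 0 z0), c3, c2, iterate_deriv_three_kappaCos, hB0,
      hB1] at h
    simp at h
    change deriv (deriv B) 0 = _
    field_simp at h ⊢
    linarith
  have hBπ : B π = π / 2 := by
    have h := (hcB π zπ).self_of_nhds
    rw [Function.comp_apply, kappaCos_pi, ← cos_pi_div_two] at h
    exact injOn_cos (hBm zπ) ⟨by linarith [pi_pos], by linarith [pi_pos]⟩ h
  have hBπ1 : deriv B π = 0 := by
    have h := hn π zπ 1
    rw [Function.iterate_one, deriv_comp_of_analyticAt (hca _) (hB π zπ), hBπ,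
      deriv_kappaCos] at h
    simpa using h
  have hBπ2 : deriv^[2] B π = 0 := by
    have h := hn π zπ 2
    rw [iterate_deriv_two_comp (hca _) (hB π zπ), hBπ, hBπ1, iterate_deriv_two_kappaCos] at h
    simpa using h
  have hBπ3 : deriv^[3] B π = 2 / π := by
    have h := hn π zπ 3
    rw [iterate_deriv_three_comp (hca _) (hB π zπ), hBπ, hBπ1, iterate_deriv_three_kappaCos] at h
    simp at h
    simp
    field_simp at h ⊢
    linarith
  -- Each further layer adds `3 · (-1) · B''(0) = 2/π` to the third derivative and fixes the lower
  -- ones.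
  have hjet : ∀ m : ℕ, deriv (cos ∘ B^[m]) 0 = 0 ∧ deriv^[2] (cos ∘ B^[m]) 0 = -1 ∧
      deriv^[3] (cos ∘ B^[m]) 0 = 2 / π * m := fun m => by
    induction m with
    | zero => simp [c2, c3]
    | succ m ih =>
      obtain ⟨i1, i2, i3⟩ := ih
      have ha : AnalyticAt ℝ (cos ∘ B^[m]) (B 0) := hiter m _ (hBm z0)
      rw [hsucc, deriv_comp_of_analyticAt ha (hB 0 z0),
        iterate_deriv_two_comp ha (hB 0 z0), iterate_deriv_three_comp ha (hB 0 z0), hB0, hB1, hB2,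
        i1, i2, i3]
      refine ⟨by ring, by ring, ?_⟩
      push_cast
      field_simp
      ring
  have hhalf : π / 2 ∈ Icc 0 π := ⟨by positivity, by linarith [pi_pos]⟩
  -- After one layer the endpoint `π` sits at `π/2`, that is at `u = 0`, where the iterates of `κ₁`
  -- are differentiable; the sign is `cos'(π/2) = -1`.
  have hmid : deriv (cos ∘ B^[m]) (π / 2) = -deriv (kappaOne^[m]) 0 := by
    obtain ⟨D, hD, -, -⟩ := hasDerivAt_iterate_kappaOne m (u := 0) (by simp)
    have hev : cos ∘ B^[m] =ᶠ[nhds (π / 2)] kappaOne^[m] ∘ cos := by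
      filter_upwards [Ioo_mem_nhds (by linarith [pi_pos] : 0 < π / 2)
        (by linarith [pi_pos] : π / 2 < π)] with θ hθ using (hk m θ (Ioo_subset_Icc_self hθ)).symm
    rw [← cos_pi_div_two] at hD
    have h := (hD.comp (π / 2) (hasDerivAt_cos (π / 2))).deriv
    rw [hev.deriv_eq, h, ← cos_pi_div_two, hD.deriv]
    simp
  have haπ : AnalyticAt ℝ (cos ∘ B^[m]) (B π) := hiter m _ (hBm zπ)
  refine ⟨cos ∘ B^[m + 1], hiter _, hk _, (hjet _).1, ?_, ?_, ?_⟩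
  · rw [hsucc, deriv_comp_of_analyticAt haπ (hB π zπ), hBπ1,
      mul_zero]
  · rw [(hjet _).2.2]
    push_cast
    rfl
  · rw [hsucc, iterate_deriv_three_comp haπ (hB π zπ), hBπ,
      hBπ1, hBπ2, hBπ3, hmid]
    ring

/-! ### From limits to asymptotic equivalence, and the conclusion. -/

theorem isEquivalent_mul_rpow_of_tendsto (d : ℕ) {φ : ℕ → ℕ} (hφ : Tendsto φ atTop atTop)
    {μ c : ℕ → ℝ} {δ : ℝ} (hδ : 0 < δ) (hc : ∀ m, δ ≤ c m)
    (h : Tendsto (fun m => μ m * (φ m : ℝ) ^ (d + 2) - c m) atTop (nhds 0)) :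
    μ ~[atTop] fun m => c m * (φ m : ℝ) ^ (-(d : ℝ) - 2) := by
  have h1 : (fun m => μ m * (φ m : ℝ) ^ (d + 2) - c m) =o[atTop] c := by
    refine ((isLittleO_one_iff ℝ).2 h).trans_isBigO (IsBigO.of_bound δ⁻¹ ?_)
    refine Eventually.of_forall fun m => ?_
    have hcm := hc m
    rw [norm_one, norm_of_nonneg (hδ.le.trans hcm), inv_mul_eq_div, le_div_iff₀ hδ, one_mul]
    exact hcm
  have h2 := h1.mul_isBigO (isBigO_refl (fun m => (φ m : ℝ) ^ (-(d : ℝ) - 2)) atTop)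
  refine h2.congr' ?_ EventuallyEq.rfl
  filter_upwards [hφ.eventually_gt_atTop 0] with m hm
  have hm' : (0 : ℝ) < φ m := by exact_mod_cast hm
  have hp : (φ m : ℝ) ^ (d + 2) * (φ m : ℝ) ^ (-(d : ℝ) - 2) = 1 := by
    rw [← rpow_natCast, ← rpow_add hm']
    push_cast
    rw [show (d : ℝ) + 2 + (-(d : ℝ) - 2) = 0 by ring, rpow_zero]
  rw [Pi.sub_apply, sub_mul, mul_assoc, hp, mul_one]

theorem sphereArea_pos {p : ℕ} (hp : 0 < p) : 0 < sphereArea p := by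
  have : 0 < Gamma ((p : ℝ) / 2) := Gamma_pos_of_pos (by positivity)
  unfold sphereArea
  positivity

/-- `K` is chosen before the depth `m`, which is what gives both constants a common slope in `L`. -/
theorem exists_tendsto_dotEigenvalue (d : ℕ) (hd : 2 ≤ d) :
    ∃ K : ℝ, 0 < K ∧ ∀ m : ℕ, Tendsto (fun k : ℕ =>
      dotEigenvalue d (kappaOne^[m + 1]) k * (k : ℝ) ^ (d + 2)
        - K * ((m + 1) + (-1) ^ k * deriv (kappaOne^[m]) 0)) atTop (nhds 0) := by
  obtain ⟨K, hK, hKt⟩ := exists_tendsto_zonalPairing d hd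
  have hr : 0 < sphereArea (d - 1) / sphereArea d :=
    div_pos (sphereArea_pos (by omega)) (sphereArea_pos (by omega))
  set r := sphereArea (d - 1) / sphereArea d with hrdef
  have hpi := pi_pos
  refine ⟨r * (K * (2 / π)), by positivity, fun m => ?_⟩
  obtain ⟨h, hh, hκ, h0, hπ, h30, h3π⟩ := exists_analytic_iterate_kappaOne_cos m
  have ht := (hKt h hh h0 hπ).const_mul r
  rw [mul_zero] at ht
  refine ht.congr fun k => ?_
  rw [dotEigenvalue_eq_zonalPairing d hd, zonalPairing_congr hκ, h30, h3π, ← hrdef]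
  ring

theorem dotEigenvalue_kappaOne_odd (d : ℕ) (hd : 2 ≤ d) {m : ℕ} (hm : 1 ≤ m) :
    dotEigenvalue d kappaOne (2 * m + 1) = 0 := by
  have hc : Continuous kappaCos :=
    continuous_iff_continuousAt.2 fun x => (analyticAt_kappaCos x).continuousAt
  have hc' : Continuous fun θ => kappaCos (π - θ) := by fun_prop
  -- The odd part of the kernel about `π/2` is linear: the difference equals `cos θ`, orthogonal to
  -- every degree above `1`. The asymptotic formula alone would only give `o(k^(-d-2))`.
  have h1 : zonalPairing d (fun θ => kappaCos θ - kappaCos (π - θ)) (2 * m + 1) = 0 := by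
    have h := zonalPairing_cos_pow d hd (show 1 < 2 * m + 1 by omega)
    simp only [pow_one] at h
    rw [← h]
    refine zonalPairing_congr (fun θ _ => ?_) _
    have := pi_ne_zero
    simp only [kappaCos, cos_pi_sub, sin_pi_sub]
    field_simp
    ring
  rw [zonalPairing_sub hc.continuousOn hc'.continuousOn, zonalPairing_reflect, pow_succ,
    pow_mul] at h1
  have h2 : zonalPairing d kappaCos (2 * m + 1) = 0 := by
    norm_num at h1
    exact h1
  rw [dotEigenvalue_eq_zonalPairing d hd, zonalPairing_congr (fun θ hθ => kappaOne_cos hθ)]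
  rw [show (fun θ => kappaCos θ) = kappaCos from rfl, h2, mul_zero]

end

theorem mainTheorem3 (d : ℕ) (hd : 2 ≤ d) :
    ∃ (cEven cOdd : ℕ → ℝ) (slope bound : ℝ), 0 < slope ∧
      (∀ L : ℕ, 3 ≤ L →
        0 < cEven L ∧ 0 < cOdd L ∧ cEven L ≠ cOdd L ∧
        ((fun k : ℕ => dotEigenvalue d (kappaRF L) k) ~[atTop]
          fun k : ℕ => (if Even k then cEven L else cOdd L) * (k : ℝ) ^ (-(d : ℝ) - 2)) ∧
        |cEven L - slope * L| ≤ bound ∧ |cOdd L - slope * L| ≤ bound) ∧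
      (∃ cShallow : ℝ, 0 < cShallow ∧
        ((fun m : ℕ => dotEigenvalue d kappaOne (2 * m)) ~[atTop]
          fun m : ℕ => cShallow * ((2 * m : ℕ) : ℝ) ^ (-(d : ℝ) - 2)) ∧
        (∀ᶠ m : ℕ in atTop, dotEigenvalue d kappaOne (2 * m + 1) = 0)) := by
  obtain ⟨K, hK, hKt⟩ := exists_tendsto_dotEigenvalue d hd
  -- `kappaRF L` has `L - 1 = m + 1` factors with `m = L - 2`. The offsets from `K L` are `K (D -
  -- 1)` and `-K (1 + D)`, both at most `2 K` in absolute value.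
  refine ⟨fun L => K * ((L - 1 : ℝ) + deriv (kappaOne^[L - 2]) 0),
    fun L => K * ((L - 1 : ℝ) - deriv (kappaOne^[L - 2]) 0), K, 2 * K, hK, fun L hL => ?_,
    2 * K, by positivity, ?_, ?_⟩
  · obtain ⟨n, rfl⟩ := Nat.exists_eq_add_of_le' hL
    have hD0 := deriv_iterate_kappaOne_zero_pos (n + 1)
    have hD1 := deriv_iterate_kappaOne_zero_le n
    have ht := hKt (n + 1)
    have hRF : kappaRF (n + 3) = kappaOne^[n + 1 + 1] := rfl
    simp only [hRF, show n + 3 - 2 = n + 1 by omega]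
    set D := deriv (kappaOne^[n + 1]) 0
    have hn : (0 : ℝ) ≤ n := Nat.cast_nonneg n
    push_cast at *
    refine ⟨mul_pos hK (by linarith), mul_pos hK (by linarith), fun h => ?_, ?_, ?_, ?_⟩
    · have := mul_left_cancel₀ hK.ne' h
      linarith
    -- The lower bound `δ` is the odd constant, the smaller of the two.
    · refine isEquivalent_mul_rpow_of_tendsto d (φ := fun k => k) tendsto_id
        (δ := K * (n + 3 - 1 - D)) (mul_pos hK (by linarith)) (fun k => ?_) (ht.congr fun k => ?_)
      · split_ifs
        · exact mul_le_mul_of_nonneg_left (by linarith) hK.le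
        · exact le_rfl
      · split_ifs with hk
        · rw [hk.neg_one_pow]
          ring
        · rw [(Nat.not_even_iff_odd.1 hk).neg_one_pow]
          ring
    · rw [show K * ((n : ℝ) + 3 - 1 + D) - K * (n + 3) = K * (D - 1) by ring, abs_mul,
        abs_of_pos hK, mul_comm]
      exact mul_le_mul_of_nonneg_right (abs_le.2 ⟨by linarith, by linarith⟩) hK.le
    · rw [show K * ((n : ℝ) + 3 - 1 - D) - K * (n + 3) = K * (-1 - D) by ring, abs_mul,
        abs_of_pos hK, mul_comm]
      exact mul_le_mul_of_nonneg_right (abs_le.2 ⟨by linarith, by linarith⟩) hK.le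
  · have hφ : Tendsto (fun m : ℕ => 2 * m) atTop atTop :=
      tendsto_id.const_mul_atTop' (by norm_num)
    refine isEquivalent_mul_rpow_of_tendsto d hφ (δ := 2 * K) (by positivity) (fun _ => le_rfl)
      (((hKt 0).comp hφ).congr fun m => ?_)
    -- For one layer the remaining iterate is the identity, so the even constant is `K (1 + 1) = 2
    -- K`.
    have h1 : deriv (kappaOne^[0]) 0 = 1 := by simp
    simp only [Function.comp_apply, h1, pow_mul, zero_add, Function.iterate_one]
    norm_num
    ring
  · filter_upwards [eventually_ge_atTop 1] with m hm using dotEigenvalue_kappaOne_odd d hd hm
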